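/- Let $N\in\mathbf N$, $0\le N_1\le N$, and $\vec p=(p_1,\dots,p_N)$ with $p_i=1$ for $i\le N_1$ and $p_i>1$ for $i>N_1$. Assume $\sum_{i=1}^N\frac1{p_i}>1$, put $p^*=\dfrac{N}{\sum_{i=1}^N\frac1{p_i}-1}$, and assume $\max_i p_i<p^*$. Let $\mathcal D(\mathbf R^N)$ be the space of real smooth compactly supported functions, $M^1(\mathbf R^N)$ the space of bounded (signed) Radon measures, $\nabla_1u=(\partial_1u,\dots,\partial_{N_1}u)$, and $$BV^{\vec p}(\mathbf R^N)=\{u\in L^{p^*}(\mathbf R^N):\ \partial_iu\in M^1(\mathbf R^N)\ (i\le N_1),\ \partial_iu\in L^{p_i}(\mathbf R^N)\ (i>N_1)\},$$ with derivatives in the sense of distributions. For $u\in BV^{\vec p}$, $\int|\nabla_1u|$ denotes the total mass of the measure $|\nabla_1u|=(\sum_{i\le N_1}(\partial_iu)^2)^{1/2}$, i.e. the supremum of $\sum_{i\le N_1}\langle\partial_iu,\psi_i\rangle$ over continuous compactly supported $\psi$ with $\sum_{i\le N_1}\psi_i^2\le1$; $|\nabla_1 u|_1$ denotes the same number, and $|\partial_iu|_{p_i}$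 is the total mass of $\partial_iu$ if $i\le N_1$ and its $L^{p_i}$ norm if $i>N_1$. A sequence $u_n\in BV^{\vec p}$ converges *weakly* to $u\in BV^{\vec p}$ if $u_n\rightharpoonup u$ weakly in $L^{p^*}$, $\int\varphi\,d(\partial_iu_n)\to\int\varphi\,d(\partial_iu)$ for every $\varphi\in\mathcal C_c(\mathbf R^N)$ and every $i\le N_1$, and $\partial_iu_n\rightharpoonup\partial_iu$ weakly in $L^{p_i}$ for every $i>N_1$. It converges *tightly* if, furthermore, $\int|\partial_iu_n|^{p_i}\to\int|\partial_iu|^{p_i}$ for every $i>N_1$ and $\int|\nabla_1u_n|\to\int|\nabla_1u|$. **(A)** For every $u:\mathbf R^N\to\mathbf R$ the following are equivalent: 1. $u\in BV^{\vec p}(\mathbf R^N)$; 2. there are $u_n\in\mathcal D(\mathbf R^N)$ converging tightly to $u$; 3. there are $u_n\in\mathcal D(\mathbf R^N)$ converging weakly to $u$; 4. $u$ is locally integrable and there are $u_n\in\mathcal D(\mathbf R^N)$ converging to $u$ in the sense of distributions, with $|\nabla_1u_n|_1+\sum_{i>N_1}|\partial_iu_n|_{p_i}$ bounded independently of $n$.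 **(B)** The Troisi embedding extends to $BV^{\vec p}$: there is $T_0>0$, depending only on $N,N_1,\vec p$, such that for all $u\in BV^{\vec p}(\mathbf R^N)$ $$T_0\,|u|_{p^*}\le\prod_{i=1}^N|\partial_iu|_{p_i}^{1/N}\quad\text{and}\quad |u|_{p^*}\le\frac1{T_0N}\Big(\sqrt{N_1}\,|\nabla_1u|_1+\sum_{i=N_1+1}^N|\partial_iu|_{p_i}\Big).$$ Moreover, every constant $T_0>0$ for which the first inequality holds for all $u\in\mathcal D(\mathbf R^N)$ is such that both inequalities hold for all $u\in BV^{\vec p}(\mathbf R^N)$. -/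

import Mathlib

open MeasureTheory Filter Topology
open scoped ENNReal ContDiff

namespace AnisoBV

/-- Real test functions on `ℝ^N`: smooth with compact support. -/
def IsTest {N : ℕ} (φ : EuclideanSpace ℝ (Fin N) → ℝ) : Prop :=
  ContDiff ℝ ∞ φ ∧ HasCompactSupport φ

/-- The classical partial derivative in the `i`-th coordinate direction. -/
noncomputable def pderiv {N : ℕ} (i : Fin N) (φ : EuclideanSpace ℝ (Fin N) → ℝ)
    (x : EuclideanSpace ℝ (Fin N)) : ℝ :=
  fderiv ℝ φ x (EuclideanSpace.single i 1)

/-- The critical exponent `p* = N / (∑ 1/p_i - 1)`. -/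
noncomputable def critExp {N : ℕ} (p : Fin N → ℝ) : ℝ :=
  (N : ℝ) / ((∑ i, 1 / p i) - 1)

/-- The first `N₁` coordinate indices. -/
def firstIdx (N N₁ : ℕ) : Finset (Fin N) :=
  Finset.univ.filter fun i => (i : ℕ) < N₁

/-- The remaining coordinate indices. -/
def lastIdx (N N₁ : ℕ) : Finset (Fin N) :=
  Finset.univ.filter fun i => N₁ ≤ (i : ℕ)

/-- The bounded measure `μ` is the `i`-th partial derivative of `u` in the sense of
distributions. -/
def HasMeasureDeriv {N : ℕ} (u : EuclideanSpace ℝ (Fin N) → ℝ) (i : Fin N)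
    (μ : SignedMeasure (EuclideanSpace ℝ (Fin N))) : Prop :=
  ∀ φ : EuclideanSpace ℝ (Fin N) → ℝ, IsTest φ →
    ∫ x, u x * pderiv i φ x = - ∫ᵛ x, φ x ∂<•μ

/-- The function `g` is the `i`-th partial derivative of `u` in the sense of distributions. -/
def HasWeakDeriv {N : ℕ} (u : EuclideanSpace ℝ (Fin N) → ℝ) (i : Fin N)
    (g : EuclideanSpace ℝ (Fin N) → ℝ) : Prop :=
  ∀ φ : EuclideanSpace ℝ (Fin N) → ℝ, IsTest φ →
    ∫ x, u x * pderiv i φ x = - ∫ x, g x * φ x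

/-- `BV^p(ℝ^N)`: functions `u ∈ L^{p*}` such that `∂_i u` is a bounded measure for the first `N₁`
indices and `∂_i u ∈ L^{p_i}` for the others. -/
def BV {N : ℕ} (N₁ : ℕ) (p : Fin N → ℝ) : Set (EuclideanSpace ℝ (Fin N) → ℝ) :=
  {u | MemLp u (ENNReal.ofReal (critExp p)) volume ∧
    (∀ i ∈ firstIdx N N₁, ∃ μ : SignedMeasure (EuclideanSpace ℝ (Fin N)), HasMeasureDeriv u i μ) ∧
    (∀ i ∈ lastIdx N N₁, ∃ g : EuclideanSpace ℝ (Fin N) → ℝ,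
      MemLp g (ENNReal.ofReal (p i)) volume ∧ HasWeakDeriv u i g)}

/-- The family of the partial derivatives of a function: `meas i` is meant to be `∂_i u` for the
first `N₁` indices and `func i` to be `∂_i u` for the others (the other entries play no role). -/
structure Grad (N : ℕ) where
  meas : Fin N → SignedMeasure (EuclideanSpace ℝ (Fin N))
  func : Fin N → EuclideanSpace ℝ (Fin N) → ℝ

/-- `u` belongs to `BV^p(ℝ^N)`, with the partial derivatives `D`. -/
structure IsBVGrad {N : ℕ} (N₁ : ℕ) (p : Fin N → ℝ) (u : EuclideanSpace ℝ (Fin N) → ℝ)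
    (D : Grad N) : Prop where
  memLp : MemLp u (ENNReal.ofReal (critExp p)) volume
  meas : ∀ i ∈ firstIdx N N₁, HasMeasureDeriv u i (D.meas i)
  func_memLp : ∀ i ∈ lastIdx N N₁, MemLp (D.func i) (ENNReal.ofReal (p i)) volume
  func : ∀ i ∈ lastIdx N N₁, HasWeakDeriv u i (D.func i)

theorem mem_BV_iff {N : ℕ} {N₁ : ℕ} {p : Fin N → ℝ} {u : EuclideanSpace ℝ (Fin N) → ℝ} :
    u ∈ BV N₁ p ↔ ∃ D : Grad N, IsBVGrad N₁ p u D := by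
  classical
  constructor
  · rintro ⟨h, h1, h2⟩
    choose! μ hμ using h1
    choose! g hg using h2
    exact ⟨⟨μ, g⟩, h, hμ, fun i hi => (hg i hi).1, fun i hi => (hg i hi).2⟩
  · rintro ⟨D, h⟩
    exact ⟨h.memLp, fun i hi => ⟨_, h.meas i hi⟩, fun i hi => ⟨_, h.func_memLp i hi, h.func i hi⟩⟩

/-- The total mass `∫ |μ|` of the vector measure `(μ_i)_{i ∈ S}`, where
`|μ| = (∑_{i ∈ S} μ_i²)^{1/2}`: the supremum of `∑ ⟨μ_i, ψ_i⟩` over the continuous compactly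
supported fields `ψ` with `∑_{i ∈ S} ψ_i² ≤ 1`. -/
noncomputable def totalMass {N : ℕ} (S : Finset (Fin N))
    (μ : Fin N → SignedMeasure (EuclideanSpace ℝ (Fin N))) : ℝ≥0∞ :=
  ⨆ ψ ∈ {ψ : Fin N → EuclideanSpace ℝ (Fin N) → ℝ |
      (∀ i, Continuous (ψ i) ∧ HasCompactSupport (ψ i)) ∧ ∀ x, ∑ i ∈ S, ψ i x ^ 2 ≤ 1},
    ENNReal.ofReal (∑ i ∈ S, ∫ᵛ x, ψ i x ∂<•(μ i))

/-- `∫ |∇₁ u|`, where `∇₁ u = (∂_1 u, …, ∂_{N₁} u)`. -/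
noncomputable def mass₁ {N : ℕ} (N₁ : ℕ) (D : Grad N) : ℝ≥0∞ :=
  totalMass (firstIdx N N₁) D.meas

/-- `|∂_i u|_{p_i}`: the total mass of `∂_i u` for the first `N₁` indices and the norm in `L^{p_i}`
for the others. -/
noncomputable def derivNorm {N : ℕ} (N₁ : ℕ) (p : Fin N → ℝ) (D : Grad N) (i : Fin N) : ℝ≥0∞ :=
  if (i : ℕ) < N₁ then totalMass {i} D.meas
  else eLpNorm (D.func i) (ENNReal.ofReal (p i)) volume

/-- Weak convergence in `L^q(ℝ^N)`, `1 < q < ∞`. -/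
def WeakLp {N : ℕ} (q : ℝ) (f : ℕ → EuclideanSpace ℝ (Fin N) → ℝ)
    (g : EuclideanSpace ℝ (Fin N) → ℝ) : Prop :=
  ∀ v : EuclideanSpace ℝ (Fin N) → ℝ, MemLp v (ENNReal.ofReal (q / (q - 1))) volume →
    Tendsto (fun n => ∫ x, f n x * v x) atTop (𝓝 (∫ x, g x * v x))

/-- Vague convergence of bounded measures. -/
def Vague {N : ℕ} (μs : ℕ → SignedMeasure (EuclideanSpace ℝ (Fin N)))
    (μ : SignedMeasure (EuclideanSpace ℝ (Fin N))) : Prop :=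
  ∀ φ : EuclideanSpace ℝ (Fin N) → ℝ, Continuous φ → HasCompactSupport φ →
    Tendsto (fun n => ∫ᵛ x, φ x ∂<•(μs n)) atTop (𝓝 (∫ᵛ x, φ x ∂<•μ))

/-- Weak convergence in `BV^p`, for functions with given partial derivatives. -/
structure WeakConvGrad {N : ℕ} (N₁ : ℕ) (p : Fin N → ℝ)
    (us : ℕ → EuclideanSpace ℝ (Fin N) → ℝ) (Ds : ℕ → Grad N)
    (u : EuclideanSpace ℝ (Fin N) → ℝ) (D : Grad N) : Prop where
  seq_grad : ∀ n, IsBVGrad N₁ p (us n) (Ds n)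
  lim_grad : IsBVGrad N₁ p u D
  weak : WeakLp (critExp p) us u
  vague : ∀ i ∈ firstIdx N N₁, Vague (fun n => (Ds n).meas i) (D.meas i)
  weak_deriv : ∀ i ∈ lastIdx N N₁, WeakLp (p i) (fun n => (Ds n).func i) (D.func i)

/-- `us n` converges weakly to `u` in `BV^p(ℝ^N)`. -/
def ConvergesWeakly {N : ℕ} (N₁ : ℕ) (p : Fin N → ℝ)
    (us : ℕ → EuclideanSpace ℝ (Fin N) → ℝ) (u : EuclideanSpace ℝ (Fin N) → ℝ) : Prop :=
  ∃ (Ds : ℕ → Grad N) (D : Grad N), WeakConvGrad N₁ p us Ds u D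

/-- `us n` converges tightly to `u` in `BV^p(ℝ^N)`. -/
def ConvergesTightly {N : ℕ} (N₁ : ℕ) (p : Fin N → ℝ)
    (us : ℕ → EuclideanSpace ℝ (Fin N) → ℝ) (u : EuclideanSpace ℝ (Fin N) → ℝ) : Prop :=
  ∃ (Ds : ℕ → Grad N) (D : Grad N), WeakConvGrad N₁ p us Ds u D ∧
    (∀ i ∈ lastIdx N N₁,
      Tendsto (fun n => ∫ x, |(Ds n).func i x| ^ p i) atTop (𝓝 (∫ x, |D.func i x| ^ p i))) ∧
    Tendsto (fun n => mass₁ N₁ (Ds n)) atTop (𝓝 (mass₁ N₁ D))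

/-- The norm `|∇₁ φ|_1 + ∑_{i > N₁} |∂_i φ|_{p_i}` of a test function. -/
noncomputable def testNorm {N : ℕ} (N₁ : ℕ) (p : Fin N → ℝ)
    (φ : EuclideanSpace ℝ (Fin N) → ℝ) : ℝ≥0∞ :=
  eLpNorm (fun x => √(∑ i ∈ firstIdx N N₁, pderiv i φ x ^ 2)) 1 volume +
    ∑ i ∈ lastIdx N N₁, eLpNorm (pderiv i φ) (ENNReal.ofReal (p i)) volume

/-- Convergence to a locally integrable function in the sense of distributions. -/
def ConvergesInDistributions {N : ℕ} (us : ℕ → EuclideanSpace ℝ (Fin N) → ℝ)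
    (u : EuclideanSpace ℝ (Fin N) → ℝ) : Prop :=
  LocallyIntegrable u volume ∧
    ∀ φ : EuclideanSpace ℝ (Fin N) → ℝ, IsTest φ →
      Tendsto (fun n => ∫ x, us n x * φ x) atTop (𝓝 (∫ x, u x * φ x))

/-- The two Troisi inequalities with constant `T₀` for a function `u` of `BV^p(ℝ^N)` with
the partial derivatives `D`. -/
def TroisiIneq {N : ℕ} (N₁ : ℕ) (p : Fin N → ℝ) (T₀ : ℝ)
    (u : EuclideanSpace ℝ (Fin N) → ℝ) (D : Grad N) : Prop :=
  ENNReal.ofReal T₀ * eLpNorm u (ENNReal.ofReal (critExp p)) volume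
      ≤ ∏ i, derivNorm N₁ p D i ^ (1 / (N : ℝ)) ∧
  eLpNorm u (ENNReal.ofReal (critExp p)) volume
      ≤ ENNReal.ofReal (1 / (T₀ * N)) *
        (ENNReal.ofReal √(N₁ : ℝ) * mass₁ N₁ D + ∑ i ∈ lastIdx N N₁, derivNorm N₁ p D i)

end AnisoBV

open AnisoBV

/-! Write `q` for the critical exponent and `a i = 1 / p i - 1 / q`. The assumptions say exactly
that the `a i` are positive and sum to one, and the proof rests on this identity.

Approximation (`exists_test_approx`). A function of BV is approximated by `η n * (K n ⋆ u)`, with `K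
n` an even mollifier and `η n` a cutoff. The delicate term is `∂_i (η n) * (K n ⋆ u)`, since `K n ⋆
u` lies in `L^q` and smallness is needed in `L^{p i}`. Isotropic cutoffs do not fit; a box with
sides of order `n ^ a i` has volume of order `n`, so `∂_i (η n)` is bounded in `L^{1 / a i}`, and
Hölder gives an error controlled by the part of `u` living on the support of `∂_i (η n)`, which
tends to zero. On the measure side, mollification is moved onto the dual field by evenness of the
kernel; since averaging preserves the constraint `∑ ψ_i² ≤ 1`, masses increase by at most a
vanishing error. As the mass is lower semicontinuous for vague convergence, it converges.

Troisi's inequality for test functions (`exists_troisi_test`). The fundamental theorem of calculus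
on coordinate lines bounds `|φ| ^ γ i` by a line integral of `γ i |φ| ^ (γ i - 1) |∂_i φ|`. The
choice `γ i = 1 + q (1 - 1 / p i)` makes Hölder produce only the `L^q` norm of `φ` and the `L^{p i}`
norm of `∂_i φ`, while the `γ i` sum to `q (N - 1)`, as the Gagliardo–Nirenberg product inequality
requires. The approximation carries the inequality to BV with the same constant
(`troisiIneq_of_test`); the sum form follows from the arithmetic-geometric mean inequality and
Cauchy–Schwarz.

Compactness (`mem_BV_of_testNorm_le`). A bound on the derivatives of test functions bounds their
`L^q` norms by Troisi. Along an ultrafilter all pairings with continuous compactly supported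
functions converge. Applied to positive and negative parts, the Riesz–Markov–Kakutani theorem turns
the limits into measures, finite under an `L^1` bound and with an `L^r` density under an `L^r`
bound, `r > 1`. Testing against smooth functions identifies these limits with `u` and its
derivatives. -/

namespace AnisoBV

variable {N : ℕ}

/-! ### Integrals against signed measures -/

section Signed

variable {X : Type*} [MeasurableSpace X]

instance isFiniteMeasure_variation (μ : SignedMeasure X) : IsFiniteMeasure μ.variation := by
  rw [← μ.totalVariation_eq_variation]; infer_instance

theorem abs_vintegral_le (μ : SignedMeasure X) {φ : X → ℝ} {C : ℝ} (h : ∀ x, |φ x| ≤ C) :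
    |∫ᵛ x, φ x ∂<•μ| ≤ C * μ.variation.real Set.univ := by
  rcases isEmpty_or_nonempty X with hX | ⟨⟨x₀⟩⟩
  · simp [VectorMeasure.integral_of_isEmpty, Measure.real, Set.univ_eq_empty_iff.2 hX]
  have hC : 0 ≤ C := (abs_nonneg _).trans (h x₀)
  have h1 := VectorMeasure.norm_integral_le_of_norm_le_const (μ := μ)
    (B := (ContinuousLinearMap.lsmul ℝ ℝ).flip) (f := φ) (C := C) (ae_of_all _ h)
  refine h1.trans ?_
  have h2 : ‖(ContinuousLinearMap.lsmul ℝ ℝ : ℝ →L[ℝ] ℝ →L[ℝ] ℝ).flip‖ ≤ 1 := by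
    rw [ContinuousLinearMap.opNorm_flip]; exact ContinuousLinearMap.opNorm_lsmul_le
  have h3 : 0 ≤ μ.variation.real Set.univ := measureReal_nonneg
  nlinarith [mul_nonneg hC h3]

/-- Splitting `g` into positive and negative parts reduces the signed integral to two ordinary ones.
This lets a test function, whose derivatives are densities, be treated as an element of BV. -/
theorem vintegral_withDensity {ν : Measure X} {g φ : X → ℝ} (hg : Integrable g ν)
    (hφm : Measurable φ) {C : ℝ} (hφ : ∀ x, |φ x| ≤ C) :
    ∫ᵛ x, φ x ∂<•(ν.withDensityᵥ g) = ∫ x, g x * φ x ∂ν := by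
  have : IsFiniteMeasure (ν.withDensity fun x => ENNReal.ofReal (g x)) :=
    isFiniteMeasure_withDensity_ofReal hg.2
  have : IsFiniteMeasure (ν.withDensity fun x => ENNReal.ofReal (-g x)) :=
    isFiniteMeasure_withDensity_ofReal hg.neg.2
  have hb : ∀ (m : Measure X) [IsFiniteMeasure m], Integrable φ m := fun m _ =>
    Integrable.of_bound hφm.aestronglyMeasurable C (ae_of_all _ hφ)
  have key : ∀ f : X → ℝ, Integrable f ν →
      ∫ x, φ x ∂(ν.withDensity fun x => ENNReal.ofReal (f x)) = ∫ x, max (f x) 0 * φ x ∂ν := by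
    intro f hf
    rw [integral_withDensity_eq_integral_toReal_smul₀ hf.aemeasurable.ennreal_ofReal
      (ae_of_all _ fun x => ENNReal.ofReal_lt_top)]
    simp [ENNReal.toReal_ofReal']
  rw [withDensityᵥ_eq_withDensity_pos_part_sub_withDensity_neg_part hg,
    VectorMeasure.integral_sub_vectorMeasure, VectorMeasure.integral_toSignedMeasure,
    VectorMeasure.integral_toSignedMeasure, key g hg, key (fun x => -g x) hg.neg,
    ← integral_sub]
  · congr 1; ext x
    rcases le_total 0 (g x) with h | h
    · simp [h]
    · simp [h]
  · exact (hg.pos_part).mul_bdd (c := C) hφm.aestronglyMeasurable (ae_of_all _ hφ)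
  · exact (hg.neg.pos_part).mul_bdd (c := C) hφm.aestronglyMeasurable (ae_of_all _ hφ)
  · rw [VectorMeasure.Integrable, Measure.variation_toSignedMeasure]; exact hb _
  · rw [VectorMeasure.Integrable, Measure.variation_toSignedMeasure]; exact hb _

end Signed


theorem vintegrable_of_hasCompactSupport (μ : SignedMeasure (EuclideanSpace ℝ (Fin N)))
    {φ : EuclideanSpace ℝ (Fin N) → ℝ} (hφ : Continuous φ) (hs : HasCompactSupport φ) :
    μ.Integrable φ :=
  hφ.integrable_of_hasCompactSupport hs

/-! ### Total mass -/

/-- The admissible fields in the definition of the total mass. -/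
def UnitFields (S : Finset (Fin N)) : Set (Fin N → EuclideanSpace ℝ (Fin N) → ℝ) :=
  {ψ | (∀ i, Continuous (ψ i) ∧ HasCompactSupport (ψ i)) ∧ ∀ x, ∑ i ∈ S, ψ i x ^ 2 ≤ 1}

theorem UnitFields.abs_le_one {S : Finset (Fin N)}
    {ψ : Fin N → EuclideanSpace ℝ (Fin N) → ℝ} (hψ : ψ ∈ UnitFields S) {i : Fin N} (hi : i ∈ S)
    (x : EuclideanSpace ℝ (Fin N)) : |ψ i x| ≤ 1 := by
  rw [← sq_le_one_iff_abs_le_one]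
  exact (Finset.single_le_sum (f := fun i => ψ i x ^ 2) (fun j _ => sq_nonneg _) hi).trans (hψ.2 x)

theorem le_totalMass {S : Finset (Fin N)} (μ : Fin N → SignedMeasure (EuclideanSpace ℝ (Fin N)))
    {ψ : Fin N → EuclideanSpace ℝ (Fin N) → ℝ} (hψ : ψ ∈ UnitFields S) :
    ENNReal.ofReal (∑ i ∈ S, ∫ᵛ x, ψ i x ∂<•(μ i)) ≤ totalMass S μ :=
  le_iSup₂_of_le ψ hψ le_rfl

theorem totalMass_le {S : Finset (Fin N)} {μ : Fin N → SignedMeasure (EuclideanSpace ℝ (Fin N))}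
    {C : ℝ≥0∞} (h : ∀ ψ ∈ UnitFields S, ENNReal.ofReal (∑ i ∈ S, ∫ᵛ x, ψ i x ∂<•(μ i)) ≤ C) :
    totalMass S μ ≤ C :=
  iSup₂_le h

theorem totalMass_lt_top (S : Finset (Fin N))
    (μ : Fin N → SignedMeasure (EuclideanSpace ℝ (Fin N))) : totalMass S μ < ⊤ := by
  refine (totalMass_le (C := ENNReal.ofReal (∑ i ∈ S, (μ i).variation.real Set.univ))
    fun ψ hψ => ENNReal.ofReal_le_ofReal (Finset.sum_le_sum fun i hi => ?_)).trans_lt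
    ENNReal.ofReal_lt_top
  have := abs_vintegral_le (μ i) (UnitFields.abs_le_one hψ hi)
  rw [one_mul] at this
  exact (le_abs_self _).trans this

/-- The total mass is a supremum of functionals that are continuous for vague convergence, hence
lower semicontinuous. -/
theorem totalMass_le_liminf {S : Finset (Fin N)}
    {μs : ℕ → Fin N → SignedMeasure (EuclideanSpace ℝ (Fin N))}
    {μ : Fin N → SignedMeasure (EuclideanSpace ℝ (Fin N))}
    (h : ∀ i ∈ S, Vague (fun n => μs n i) (μ i)) :
    totalMass S μ ≤ liminf (fun n => totalMass S (μs n)) atTop := by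
  refine totalMass_le fun ψ hψ => ?_
  have h1 : Tendsto (fun n => ENNReal.ofReal (∑ i ∈ S, ∫ᵛ x, ψ i x ∂<•(μs n i))) atTop
      (𝓝 (ENNReal.ofReal (∑ i ∈ S, ∫ᵛ x, ψ i x ∂<•(μ i)))) :=
    ENNReal.tendsto_ofReal (tendsto_finsetSum _ fun i hi => h i hi _ (hψ.1 i).1 (hψ.1 i).2)
  rw [← h1.liminf_eq]
  exact liminf_le_liminf (Eventually.of_forall fun n => le_totalMass _ hψ)

theorem tendsto_totalMass {S : Finset (Fin N)}
    {μs : ℕ → Fin N → SignedMeasure (EuclideanSpace ℝ (Fin N))}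
    {μ : Fin N → SignedMeasure (EuclideanSpace ℝ (Fin N))}
    (h : ∀ i ∈ S, Vague (fun n => μs n i) (μ i)) {ε : ℕ → ℝ≥0∞} (hε : Tendsto ε atTop (𝓝 0))
    (hle : ∀ n, totalMass S (μs n) ≤ totalMass S μ + ε n) :
    Tendsto (fun n => totalMass S (μs n)) atTop (𝓝 (totalMass S μ)) := by
  refine tendsto_of_le_liminf_of_limsup_le (totalMass_le_liminf h) ?_
  have h1 : Tendsto (fun n => totalMass S μ + ε n) atTop (𝓝 (totalMass S μ + 0)) :=
    tendsto_const_nhds.add hε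
  rw [add_zero] at h1
  rw [← h1.limsup_eq]
  exact limsup_le_limsup (Eventually.of_forall hle)

/-- Cauchy–Schwarz in dual form: scalar fields almost optimal for the single components, all divided
by `√S.card`, together form an admissible field for the vector. -/
theorem sum_totalMass_singleton_le (S : Finset (Fin N))
    (μ : Fin N → SignedMeasure (EuclideanSpace ℝ (Fin N))) :
    ∑ i ∈ S, totalMass {i} μ ≤ ENNReal.ofReal √(S.card : ℝ) * totalMass S μ := by
  rcases S.eq_empty_or_nonempty with rfl | hS
  · simp
  have hc : (0 : ℝ) < S.card := by exact_mod_cast hS.card_pos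
  refine ENNReal.le_of_forall_pos_le_add fun ε hε _ => ?_
  -- Near-maximisers with slack `ε / S.card`, so that the errors add up to `ε`. The pairing is also
  -- required to be nonnegative because `ENNReal.ofReal` must commute with the sum below. If none
  -- existed, every admissible field would stay below the mass by the slack; the zero field shows
  -- that the slack is then smaller than the mass.
  have hex : ∀ i, ∃ ψ : EuclideanSpace ℝ (Fin N) → ℝ, Continuous ψ ∧ HasCompactSupport ψ ∧
      (∀ x, ψ x ^ 2 ≤ 1) ∧ 0 ≤ ∫ᵛ x, ψ x ∂<•(μ i) ∧
      totalMass {i} μ ≤ ENNReal.ofReal (∫ᵛ x, ψ x ∂<•(μ i)) + ε / S.card := by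
    intro i
    by_contra! hcon
    have hpos : (ε : ℝ≥0∞) / S.card ≠ 0 :=
      (ENNReal.div_pos (by exact_mod_cast hε.ne') (by simp)).ne'
    have h0 : (ε : ℝ≥0∞) / S.card < totalMass {i} μ := by
      have := hcon 0 continuous_zero HasCompactSupport.zero (by simp) (by simp)
      simpa using this
    have : totalMass {i} μ ≤ totalMass {i} μ - ε / S.card := by
      refine totalMass_le fun ψ hψ => ?_
      rw [Finset.sum_singleton]
      rcases le_total 0 (∫ᵛ x, ψ i x ∂<•(μ i)) with h | h
      · have := hcon (ψ i) (hψ.1 i).1 (hψ.1 i).2 (fun x => by simpa using hψ.2 x) h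
        exact ENNReal.le_sub_of_add_le_right
          (ENNReal.div_ne_top ENNReal.coe_ne_top (by simpa using hS.ne_empty)) this.le
      · simp [ENNReal.ofReal_of_nonpos h]
    exact absurd this (not_le.2 (ENNReal.sub_lt_self (totalMass_lt_top _ _).ne
      h0.ne_bot hpos))
  choose ψ hψc hψs hψ1 hψ0 hψ using hex
  have hf : (fun i x => (√(S.card : ℝ))⁻¹ * ψ i x) ∈ UnitFields S := by
    refine ⟨fun i => ⟨continuous_const.mul (hψc i), (hψs i).mul_left⟩, fun x => ?_⟩
    calc ∑ i ∈ S, ((√(S.card : ℝ))⁻¹ * ψ i x) ^ 2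
        ≤ ∑ i ∈ S, (S.card : ℝ)⁻¹ := Finset.sum_le_sum fun i _ => by
          rw [mul_pow, inv_pow, Real.sq_sqrt hc.le]
          exact mul_le_of_le_one_right (by positivity) (hψ1 i x)
      _ = 1 := by simp [hc.ne']
  calc ∑ i ∈ S, totalMass {i} μ
      ≤ ∑ i ∈ S, (ENNReal.ofReal (∫ᵛ x, ψ i x ∂<•(μ i)) + ε / S.card) :=
        Finset.sum_le_sum fun i _ => hψ i
    _ = ENNReal.ofReal (∑ i ∈ S, ∫ᵛ x, ψ i x ∂<•(μ i)) + ε := by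
        rw [Finset.sum_add_distrib, ENNReal.ofReal_sum_of_nonneg fun i _ => hψ0 i,
          Finset.sum_const, nsmul_eq_mul, ENNReal.mul_div_cancel (by simpa using hS.ne_empty)
          (by simp)]
    _ ≤ _ := by
        gcongr
        refine le_trans (le_of_eq ?_) (mul_le_mul_right (le_totalMass μ hf) _)
        rw [← ENNReal.ofReal_mul (by positivity)]
        congr 1
        rw [Finset.mul_sum]
        refine Finset.sum_congr rfl fun i _ => ?_
        have := VectorMeasure.integral_fun_smul (μ := μ i)
          (B := (ContinuousLinearMap.lsmul ℝ ℝ : ℝ →L[ℝ] ℝ →L[ℝ] ℝ).flip)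
          ((√(S.card : ℝ))⁻¹) (ψ i)
        simp only [smul_eq_mul] at this
        rw [this, ← mul_assoc, mul_inv_cancel₀ (by positivity), one_mul]

/-! ### Test functions -/

theorem IsTest.contDiff_pderiv {φ : EuclideanSpace ℝ (Fin N) → ℝ} (hφ : IsTest φ) (i : Fin N) :
    IsTest (pderiv i φ) := by
  refine ⟨?_, ?_⟩
  · exact (hφ.1.fderiv_right (m := ∞) (by simp)).clm_apply contDiff_const
  · exact hφ.2.fderiv_apply (𝕜 := ℝ) _

theorem IsTest.continuous {φ : EuclideanSpace ℝ (Fin N) → ℝ} (hφ : IsTest φ) : Continuous φ :=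
  hφ.1.continuous

theorem IsTest.memLp {φ : EuclideanSpace ℝ (Fin N) → ℝ} (hφ : IsTest φ) (q : ℝ≥0∞) :
    MemLp φ q volume :=
  hφ.continuous.memLp_of_hasCompactSupport hφ.2

theorem IsTest.integrable {φ : EuclideanSpace ℝ (Fin N) → ℝ} (hφ : IsTest φ) :
    Integrable φ volume :=
  hφ.continuous.integrable_of_hasCompactSupport hφ.2

theorem exists_abs_le_of_hasCompactSupport {φ : EuclideanSpace ℝ (Fin N) → ℝ} (hc : Continuous φ)
    (hs : HasCompactSupport φ) : ∃ C, ∀ x, |φ x| ≤ C := by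
  obtain ⟨C, hC⟩ := hs.exists_bound_of_continuous hc
  exact ⟨C, hC⟩

theorem IsTest.hasWeakDeriv {φ : EuclideanSpace ℝ (Fin N) → ℝ} (hφ : IsTest φ) (i : Fin N) :
    HasWeakDeriv φ i (pderiv i φ) := by
  intro η hη
  have hint : ∀ {f g : EuclideanSpace ℝ (Fin N) → ℝ}, IsTest f → IsTest g →
      Integrable (fun x => f x * g x) volume := fun hf hg =>
    (hf.continuous.mul hg.continuous).integrable_of_hasCompactSupport hf.2.mul_right
  exact integral_mul_fderiv_eq_neg_fderiv_mul_of_integrable (hint (hφ.contDiff_pderiv i) hη)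
    (hint hφ (hη.contDiff_pderiv i)) (hint hφ hη)
    (fun x _ => hφ.1.differentiable (by simp) x) (fun x _ => hη.1.differentiable (by simp) x)

/-- The partial derivatives of a test function. -/
noncomputable def testGrad (φ : EuclideanSpace ℝ (Fin N) → ℝ) : Grad N :=
  ⟨fun i => volume.withDensityᵥ (pderiv i φ), fun i => pderiv i φ⟩

theorem vintegral_testGrad {φ ψ : EuclideanSpace ℝ (Fin N) → ℝ} (hφ : IsTest φ)
    (hψc : Continuous ψ) (hψs : HasCompactSupport ψ) (i : Fin N) :
    ∫ᵛ x, ψ x ∂<•((testGrad φ).meas i) = ∫ x, pderiv i φ x * ψ x := by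
  obtain ⟨C, hC⟩ := exists_abs_le_of_hasCompactSupport hψc hψs
  exact vintegral_withDensity (hφ.contDiff_pderiv i).integrable hψc.measurable hC

theorem IsTest.isBVGrad {φ : EuclideanSpace ℝ (Fin N) → ℝ} (hφ : IsTest φ) (N₁ : ℕ)
    (p : Fin N → ℝ) : IsBVGrad N₁ p φ (testGrad φ) where
  memLp := hφ.memLp _
  meas i _ η hη := by
    rw [vintegral_testGrad hφ hη.continuous hη.2]
    exact hφ.hasWeakDeriv i η hη
  func_memLp i _ := (hφ.contDiff_pderiv i).memLp _
  func i _ := hφ.hasWeakDeriv i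

/-- The `L^1` norm is attained in the limit by pairing with continuous approximations of the sign of
the derivative. Troisi for test functions involves `L^1` norms while the approximation controls
masses; this inequality links them. -/
theorem IsTest.eLpNorm_pderiv_le_totalMass {φ : EuclideanSpace ℝ (Fin N) → ℝ} (hφ : IsTest φ)
    (i : Fin N) : eLpNorm (pderiv i φ) 1 volume ≤ totalMass {i} (testGrad φ).meas := by
  have hg := hφ.contDiff_pderiv i
  set g := pderiv i φ with hgdef
  -- Truncating `n * g` at height one gives a continuous field that vanishes where `g` does, hence
  -- has compact support, and equals the sign of `g` at each point for large `n`.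
  let ψ : ℕ → EuclideanSpace ℝ (Fin N) → ℝ := fun n x => max (-1) (min 1 (n * g x))
  have hψ1 : ∀ n x, |ψ n x| ≤ 1 := fun n x => abs_le.2 ⟨le_max_left _ _, max_le (by norm_num)
    (min_le_left _ _)⟩
  have hψc : ∀ n, Continuous (ψ n) := fun n =>
    continuous_const.max (continuous_const.min (continuous_const.mul hg.continuous))
  have hψs : ∀ n, HasCompactSupport (ψ n) := fun n =>
    hg.2.mono fun x hx => by
      simp only [Function.mem_support] at hx ⊢
      contrapose! hx
      simp [ψ, hx]
  have hlim : Tendsto (fun n => ∫ x, g x * ψ n x) atTop (𝓝 (∫ x, ‖g x‖)) := by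
    refine tendsto_integral_of_dominated_convergence (fun x => ‖g x‖)
      (fun n => (hg.continuous.mul (hψc n)).aestronglyMeasurable) hg.integrable.norm
      (fun n => ae_of_all _ fun x => ?_) (ae_of_all _ fun x => ?_)
    · rw [norm_mul]
      exact mul_le_of_le_one_right (norm_nonneg _) (hψ1 n x)
    · rcases eq_or_ne (g x) 0 with h0 | h0
      · simp [h0]
      refine tendsto_const_nhds.congr' ?_
      obtain ⟨m, hm⟩ := exists_nat_ge (|g x|⁻¹)
      filter_upwards [eventually_ge_atTop m] with n hn
      have hn1 : 1 ≤ (n : ℝ) * |g x| := by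
        have : |g x|⁻¹ ≤ n := hm.trans (by exact_mod_cast hn)
        calc (1 : ℝ) = |g x|⁻¹ * |g x| := (inv_mul_cancel₀ (abs_ne_zero.2 h0)).symm
          _ ≤ _ := by gcongr
      rw [Real.norm_eq_abs]
      rcases le_total 0 (g x) with h | h
      · rw [abs_of_nonneg h] at hn1 ⊢
        simp [ψ, hn1]
      · rw [abs_of_nonpos h] at hn1 ⊢
        have h2 : (n : ℝ) * g x ≤ -1 := by linarith
        have h3 : min 1 ((n : ℝ) * g x) ≤ -1 := (min_le_right _ _).trans h2
        simp [ψ, max_eq_left h3]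
  have hle : ∀ n, ENNReal.ofReal (∫ x, g x * ψ n x) ≤ totalMass {i} (testGrad φ).meas := by
    intro n
    have hU : (fun _ : Fin N => ψ n) ∈ UnitFields {i} :=
      ⟨fun _ => ⟨hψc n, hψs n⟩, fun x => by
        simpa [sq_le_one_iff_abs_le_one] using hψ1 n x⟩
    have := le_totalMass (testGrad φ).meas hU
    rwa [Finset.sum_singleton, vintegral_testGrad hφ (hψc n) (hψs n)] at this
  rw [eLpNorm_one_eq_lintegral_enorm, ← ofReal_integral_norm_eq_lintegral_enorm hg.integrable]
  exact le_of_tendsto (ENNReal.tendsto_ofReal hlim) (Eventually.of_forall hle)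

/-! ### Mollification -/


/-- The convolution `K ⋆ u`. -/
noncomputable def moll (K u : EuclideanSpace ℝ (Fin N) → ℝ) (x : EuclideanSpace ℝ (Fin N)) : ℝ :=
  ∫ y, K (x - y) * u y

theorem moll_eq_convolution (K u : EuclideanSpace ℝ (Fin N) → ℝ) :
    moll K u = convolution K u (ContinuousLinearMap.lsmul ℝ ℝ) volume := by
  ext x; rw [convolution_lsmul_swap]; rfl

theorem moll_apply (K u : EuclideanSpace ℝ (Fin N) → ℝ) (x : EuclideanSpace ℝ (Fin N)) :
    moll K u x = ∫ t, K t * u (x - t) := by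
  rw [moll_eq_convolution]; rfl

theorem contDiff_moll {K u : EuclideanSpace ℝ (Fin N) → ℝ} (hK : IsTest K)
    (hu : LocallyIntegrable u volume) : ContDiff ℝ ∞ (moll K u) := by
  rw [moll_eq_convolution]
  exact hK.2.contDiff_convolution_left _ (n := ⊤) hK.1 hu

theorem moll_integrable {K u : EuclideanSpace ℝ (Fin N) → ℝ} (hK : IsTest K)
    (hu : LocallyIntegrable u volume) (x : EuclideanSpace ℝ (Fin N)) :
    Integrable (fun t => K t * u (x - t)) volume :=
  hK.2.convolutionExists_left (ContinuousLinearMap.lsmul ℝ ℝ) hK.continuous hu x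

theorem pderiv_moll {K u : EuclideanSpace ℝ (Fin N) → ℝ} (hK : IsTest K)
    (hu : LocallyIntegrable u volume) (i : Fin N) :
    pderiv i (moll K u) = moll (pderiv i K) u := by
  ext x
  have h1 := hK.2.hasFDerivAt_convolution_left (ContinuousLinearMap.lsmul ℝ ℝ)
    (hK.1.of_le (by simp)) hu x
  rw [← moll_eq_convolution] at h1
  rw [pderiv, h1.fderiv, moll_apply, convolution_def, ContinuousLinearMap.integral_apply]
  · rfl
  · exact (hK.2.fderiv (𝕜 := ℝ)).convolutionExists_left _ (hK.1.continuous_fderiv (by simp)) hu x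

theorem isTest_moll {K ζ : EuclideanSpace ℝ (Fin N) → ℝ} (hK : IsTest K) (hζ : Continuous ζ)
    (hs : HasCompactSupport ζ) : IsTest (moll K ζ) := by
  refine ⟨contDiff_moll hK hζ.locallyIntegrable, ?_⟩
  rw [moll_eq_convolution]
  exact hK.2.convolution _ hs

/-- A nonnegative even smooth kernel of mass one, supported in the ball of radius `ε`. -/
structure IsMollifier (K : EuclideanSpace ℝ (Fin N) → ℝ) (ε : ℝ) : Prop where
  test : IsTest K
  nonneg : ∀ x, 0 ≤ K x
  integral_one : ∫ x, K x = 1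
  even : ∀ x, K (-x) = K x
  eq_zero : ∀ x, ε ≤ ‖x‖ → K x = 0

theorem exists_isMollifier {ε : ℝ} (hε : 0 < ε) :
    ∃ K : EuclideanSpace ℝ (Fin N) → ℝ, IsMollifier K ε := by
  let b : ContDiffBump (0 : EuclideanSpace ℝ (Fin N)) := ⟨ε / 2, ε, by positivity, by linarith⟩
  refine ⟨b.normed volume, ⟨b.contDiff_normed, b.hasCompactSupport_normed⟩,
    b.nonneg_normed, b.integral_normed, b.normed_neg, fun x hx => ?_⟩
  rw [← Function.notMem_support, b.support_normed_eq]
  simpa using hx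

/-- Jensen for the squared norm, by hand: if `a` is the averaged vector and `A = |a|²`, then `A` is
the average of `a · ψ ≤ (|a|² + |ψ|²) / 2`, so `A ≤ (A + 1) / 2`. -/
theorem sum_sq_moll_le_one {K : EuclideanSpace ℝ (Fin N) → ℝ} {ε : ℝ} (hK : IsMollifier K ε)
    {S : Finset (Fin N)} {ψ : Fin N → EuclideanSpace ℝ (Fin N) → ℝ}
    (hψ : ψ ∈ UnitFields S) (x : EuclideanSpace ℝ (Fin N)) :
    ∑ i ∈ S, moll K (ψ i) x ^ 2 ≤ 1 := by
  set a : Fin N → ℝ := fun i => moll K (ψ i) x with ha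
  set A := ∑ i ∈ S, a i ^ 2 with hA
  have hint : ∀ i, Integrable (fun t => K t * ψ i (x - t)) volume := fun i =>
    moll_integrable hK.test (hψ.1 i).1.locallyIntegrable x
  have h1 : A = ∫ t, ∑ i ∈ S, a i * (K t * ψ i (x - t)) := by
    rw [integral_finsetSum _ fun i _ => (hint i).const_mul _]
    refine Finset.sum_congr rfl fun i _ => ?_
    rw [integral_const_mul, ← moll_apply, sq]
  have h2 : ∫ t, ∑ i ∈ S, a i * (K t * ψ i (x - t)) ≤ ∫ t, K t * ((A + 1) / 2) := by
    refine integral_mono (integrable_finsetSum _ fun i _ => (hint i).const_mul _)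
      (hK.test.integrable.mul_const _) fun t => ?_
    have h3 : ∑ i ∈ S, a i * (K t * ψ i (x - t)) ≤
        ∑ i ∈ S, K t * ((a i ^ 2 + ψ i (x - t) ^ 2) / 2) := by
      refine Finset.sum_le_sum fun i _ => ?_
      have : a i * ψ i (x - t) ≤ (a i ^ 2 + ψ i (x - t) ^ 2) / 2 := by
        nlinarith [sq_nonneg (a i - ψ i (x - t))]
      nlinarith [mul_le_mul_of_nonneg_left this (hK.nonneg t)]
    refine h3.trans ?_
    rw [← Finset.mul_sum, ← Finset.sum_div, Finset.sum_add_distrib]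
    exact mul_le_mul_of_nonneg_left (by linarith [hψ.2 (x - t)]) (hK.nonneg t)
  rw [integral_mul_const, hK.integral_one, ← h1] at h2
  linarith

theorem moll_mem_unitFields {K : EuclideanSpace ℝ (Fin N) → ℝ} {ε : ℝ} (hK : IsMollifier K ε)
    {S : Finset (Fin N)} {ψ : Fin N → EuclideanSpace ℝ (Fin N) → ℝ}
    (hψ : ψ ∈ UnitFields S) : (fun i => moll K (ψ i)) ∈ UnitFields S :=
  ⟨fun i => ⟨(isTest_moll hK.test (hψ.1 i).1 (hψ.1 i).2).continuous,
    (isTest_moll hK.test (hψ.1 i).1 (hψ.1 i).2).2⟩, sum_sq_moll_le_one hK hψ⟩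

theorem abs_moll_le {K : EuclideanSpace ℝ (Fin N) → ℝ} {ε : ℝ} (hK : IsMollifier K ε)
    {ζ : EuclideanSpace ℝ (Fin N) → ℝ} {C : ℝ} (hC : ∀ x, |ζ x| ≤ C)
    (x : EuclideanSpace ℝ (Fin N)) : |moll K ζ x| ≤ C := by
  rw [moll_apply, ← Real.norm_eq_abs]
  refine (norm_integral_le_of_norm_le (hK.test.integrable.mul_const C)
    (ae_of_all _ fun t => ?_)).trans ?_
  · rw [norm_mul, Real.norm_of_nonneg (hK.nonneg t)]
    exact mul_le_mul_of_nonneg_left (hC _) (hK.nonneg t)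
  · rw [integral_mul_const, hK.integral_one, one_mul]

theorem moll_sub_eq {K : EuclideanSpace ℝ (Fin N) → ℝ} {ε : ℝ} (hK : IsMollifier K ε)
    {u : EuclideanSpace ℝ (Fin N) → ℝ} (hu : LocallyIntegrable u volume)
    (x : EuclideanSpace ℝ (Fin N)) :
    moll K u x - u x = ∫ t, K t * (u (x - t) - u x) := by
  simp_rw [mul_sub]
  rw [integral_sub (moll_integrable hK.test hu x) (hK.test.integrable.mul_const _),
    integral_mul_const, hK.integral_one, one_mul, moll_apply]

theorem tendsto_moll_apply {K : ℕ → EuclideanSpace ℝ (Fin N) → ℝ} {ε : ℕ → ℝ}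
    (hK : ∀ n, IsMollifier (K n) (ε n)) (hε : Tendsto ε atTop (𝓝 0))
    {ζ : EuclideanSpace ℝ (Fin N) → ℝ} (hζ : Continuous ζ) (x : EuclideanSpace ℝ (Fin N)) :
    Tendsto (fun n => moll (K n) ζ x) atTop (𝓝 (ζ x)) := by
  rw [Metric.tendsto_atTop]
  intro δ hδ
  obtain ⟨r, hr, hrζ⟩ := Metric.continuous_iff.1 hζ x (δ / 2) (by positivity)
  obtain ⟨m, hm⟩ := (eventually_atTop.1 (hε.eventually_lt_const hr))
  refine ⟨m, fun n hn => ?_⟩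
  rw [Real.dist_eq, moll_sub_eq (hK n) hζ.locallyIntegrable, ← Real.norm_eq_abs]
  refine (norm_integral_le_of_norm_le ((hK n).test.integrable.mul_const (δ / 2))
    (ae_of_all _ fun t => ?_)).trans_lt ?_
  · rw [norm_mul, Real.norm_of_nonneg ((hK n).nonneg t)]
    rcases le_or_gt (ε n) ‖t‖ with h | h
    · simp [(hK n).eq_zero t h]
    · refine mul_le_mul_of_nonneg_left (hrζ _ ?_).le ((hK n).nonneg t)
      rw [dist_eq_norm]
      simpa using h.trans (hm n hn)
  · rw [integral_mul_const, (hK n).integral_one]; linarith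

theorem IsTest.sub_left {K : EuclideanSpace ℝ (Fin N) → ℝ} (hK : IsTest K)
    (x : EuclideanSpace ℝ (Fin N)) : IsTest fun y => K (x - y) :=
  ⟨hK.1.comp (contDiff_const.sub contDiff_id),
    hK.2.comp_homeomorph (Homeomorph.subLeft x)⟩

theorem pderiv_sub_left {K : EuclideanSpace ℝ (Fin N) → ℝ} (hK : IsTest K)
    (x y : EuclideanSpace ℝ (Fin N)) (i : Fin N) :
    pderiv i (fun y => K (x - y)) y = - pderiv i K (x - y) := by
  have h1 : HasFDerivAt K (fderiv ℝ K (x - y)) (x - y) :=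
    (hK.1.differentiable (by simp) _).hasFDerivAt
  have h2 : HasFDerivAt (fun y => x - y) (-ContinuousLinearMap.id ℝ (EuclideanSpace ℝ (Fin N))) y :=
    (hasFDerivAt_id y).const_sub x
  have h3 := h1.comp y h2
  have h4 : fderiv ℝ (fun y => K (x - y)) y = _ := h3.fderiv
  rw [pderiv, h4]
  simp [pderiv]

theorem HasWeakDeriv.pderiv_moll {K u g : EuclideanSpace ℝ (Fin N) → ℝ} {i : Fin N}
    (hK : IsTest K) (hu : LocallyIntegrable u volume) (h : HasWeakDeriv u i g) :
    pderiv i (moll K u) = moll K g := by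
  rw [AnisoBV.pderiv_moll hK hu]
  ext x
  have h1 := h _ (hK.sub_left x)
  simp_rw [pderiv_sub_left hK, mul_neg, integral_neg, neg_inj] at h1
  simp_rw [moll, mul_comm _ (u _), mul_comm _ (g _)]
  exact h1

theorem pderiv_neg_of_even {K : EuclideanSpace ℝ (Fin N) → ℝ} (hK : IsTest K)
    (he : ∀ x, K (-x) = K x) (i : Fin N) (x : EuclideanSpace ℝ (Fin N)) :
    pderiv i K (-x) = - pderiv i K x := by
  have h := pderiv_sub_left hK 0 x i
  simp only [zero_sub, he] at h
  have : pderiv i (fun y => K y) x = pderiv i K x := rfl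
  linarith

theorem integral_mul_moll {k ζ u : EuclideanSpace ℝ (Fin N) → ℝ} (hk : Continuous k)
    (hks : HasCompactSupport k) (hζ : Continuous ζ) (hs : HasCompactSupport ζ)
    (hu : LocallyIntegrable u volume) :
    ∫ x, ζ x * moll k u x = ∫ y, u y * ∫ x, k (x - y) * ζ x := by
  -- Only the values of `u` on the compact set `supp ζ - supp k` enter, so local integrability of
  -- `u` is enough for Fubini.
  let T : Set (EuclideanSpace ℝ (Fin N)) :=
    (fun z : EuclideanSpace ℝ (Fin N) × EuclideanSpace ℝ (Fin N) => z.1 - z.2) ''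
      (tsupport ζ ×ˢ tsupport k)
  have hT : IsCompact T := (hs.isCompact.prod hks.isCompact).image (by fun_prop)
  have hzero : ∀ x y, ζ x * (k (x - y) * u y) = ζ x * T.indicator u y * k (x - y) := by
    intro x y
    by_cases hy : y ∈ T
    · rw [Set.indicator_of_mem hy]; ring
    · rw [Set.indicator_of_notMem hy]
      by_cases hx : x ∈ tsupport ζ
      · have : k (x - y) = 0 := by
          apply image_eq_zero_of_notMem_tsupport
          intro hxy
          exact hy ⟨(x, x - y), ⟨hx, hxy⟩, by simp⟩
        simp [this]
      · simp [image_eq_zero_of_notMem_tsupport hx]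
  obtain ⟨C, hC⟩ := exists_abs_le_of_hasCompactSupport hk hks
  have hi : Integrable (Function.uncurry fun x y => ζ x * (k (x - y) * u y))
      (volume.prod volume) := by
    have h1 : Integrable (fun z : EuclideanSpace ℝ (Fin N) × EuclideanSpace ℝ (Fin N) =>
        ζ z.1 * T.indicator u z.2) (volume.prod volume) :=
      (hζ.integrable_of_hasCompactSupport hs).mul_prod
        ((integrable_indicator_iff hT.measurableSet).2 (hu.integrableOn_isCompact hT))
    have hkc : Continuous fun z : EuclideanSpace ℝ (Fin N) × EuclideanSpace ℝ (Fin N) =>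
        k (z.1 - z.2) := by fun_prop
    have h2 := h1.mul_bdd (c := C) hkc.aestronglyMeasurable (ae_of_all _ fun z => hC _)
    refine h2.congr (ae_of_all _ fun z => ?_)
    exact (hzero z.1 z.2).symm
  calc ∫ x, ζ x * moll k u x = ∫ x, ∫ y, ζ x * (k (x - y) * u y) := by
        simp_rw [moll, integral_const_mul]
    _ = ∫ y, ∫ x, ζ x * (k (x - y) * u y) := integral_integral_swap hi
    _ = _ := by
        congr 1; ext y
        rw [← integral_const_mul]
        congr 1; ext x; ring

/-- Evenness of `K` makes `∂_i K` odd, so transposing the convolution returns `-∂_i (K ⋆ ζ)`, and `K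
⋆ ζ` is an admissible test function for the distributional derivative. The measure is thus never
convolved; the mollifier acts on the dual side only. -/
theorem HasMeasureDeriv.integral_mul_pderiv_moll {K u ζ : EuclideanSpace ℝ (Fin N) → ℝ} {ε : ℝ}
    (hK : IsMollifier K ε) (hu : LocallyIntegrable u volume) {i : Fin N}
    {μ : SignedMeasure (EuclideanSpace ℝ (Fin N))} (h : HasMeasureDeriv u i μ)
    (hζ : Continuous ζ) (hs : HasCompactSupport ζ) :
    ∫ x, ζ x * pderiv i (moll K u) x = ∫ᵛ x, moll K ζ x ∂<•μ := by
  have hK' := hK.test.contDiff_pderiv i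
  rw [pderiv_moll hK.test hu, integral_mul_moll hK'.continuous hK'.2 hζ hs hu]
  have h1 : ∀ y, ∫ x, pderiv i K (x - y) * ζ x = - pderiv i (moll K ζ) y := by
    intro y
    rw [pderiv_moll hK.test hζ.locallyIntegrable, moll, ← integral_neg]
    congr 1; ext x
    rw [← neg_sub y x, pderiv_neg_of_even hK.test hK.even]; ring
  simp_rw [h1, mul_neg, integral_neg]
  rw [h _ (isTest_moll hK.test hζ hs), neg_neg]

/-! ### Convergence of mollifications in `L^q` -/

theorem tendsto_eLpNorm_translate {q : ℝ≥0∞} [Fact (1 ≤ q)] (hq : q ≠ ⊤)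
    {f : EuclideanSpace ℝ (Fin N) → ℝ} (hf : MemLp f q volume) :
    Tendsto (fun t => eLpNorm (fun x => f (x - t) - f x) q volume) (𝓝 0) (𝓝 0) := by
  let τ : EuclideanSpace ℝ (Fin N) → C(EuclideanSpace ℝ (Fin N), EuclideanSpace ℝ (Fin N)) :=
    fun t => ⟨fun x => x - t, by fun_prop⟩
  have hτ : Continuous τ := by
    have : Continuous (Function.uncurry fun (t x : EuclideanSpace ℝ (Fin N)) => x - t) := by
      fun_prop
    exact ContinuousMap.continuous_of_continuous_uncurry τ this
  have hm : ∀ t, MeasurePreserving (τ t) volume volume := fun t =>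
    measurePreserving_sub_right volume t
  have h1 : Continuous fun t => Lp.compMeasurePreserving (τ t) (hm t) (hf.toLp f) :=
    continuous_const.compMeasurePreservingLp hτ hm hq
  have h2 := (h1.tendsto 0)
  rw [tendsto_iff_edist_tendsto_0] at h2
  refine h2.congr fun t => ?_
  rw [Lp.toLp_compMeasurePreserving, Lp.toLp_compMeasurePreserving, Lp.edist_toLp_toLp]
  congr 1
  ext x
  simp [τ]

/-- Jensen: `K` is the density of a probability measure, for which the `L^1` norm is at most the
`L^q` norm. -/
theorem rpow_lintegral_kernel_le {K : EuclideanSpace ℝ (Fin N) → ℝ} {ε : ℝ}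
    (hK : IsMollifier K ε) {q : ℝ} (hq : 1 ≤ q) {g : EuclideanSpace ℝ (Fin N) → ℝ}
    (hg : Measurable g) :
    (∫⁻ t, ENNReal.ofReal (K t) * ‖g t‖ₑ) ^ q ≤ ∫⁻ t, ENNReal.ofReal (K t) * ‖g t‖ₑ ^ q := by
  have hKm : Measurable fun t => ENNReal.ofReal (K t) := hK.test.continuous.measurable.ennreal_ofReal
  have hP : IsProbabilityMeasure (volume.withDensity fun t => ENNReal.ofReal (K t)) := by
    constructor
    rw [withDensity_apply _ MeasurableSet.univ, Measure.restrict_univ,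
      ← ofReal_integral_eq_lintegral_ofReal hK.test.integrable (ae_of_all _ hK.nonneg),
      hK.integral_one, ENNReal.ofReal_one]
  have h := eLpNorm'_le_eLpNorm'_of_exponent_le one_pos hq
    (volume.withDensity fun t => ENNReal.ofReal (K t)) hg.aestronglyMeasurable
  rw [eLpNorm', eLpNorm'] at h
  simp only [ENNReal.rpow_one, div_one] at h
  have hq0 : q ≠ 0 := by positivity
  rw [lintegral_withDensity_eq_lintegral_mul _ hKm hg.enorm,
    lintegral_withDensity_eq_lintegral_mul _ hKm (hg.enorm.pow_const q)] at h
  have h' := ENNReal.rpow_le_rpow h (zero_le_one.trans hq)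
  rwa [← ENNReal.rpow_mul, one_div, inv_mul_cancel₀ hq0, ENNReal.rpow_one] at h'

theorem moll_congr {K u v : EuclideanSpace ℝ (Fin N) → ℝ} (h : u =ᵐ[volume] v) :
    moll K u = moll K v := by
  ext x
  exact integral_congr_ae (h.mono fun y hy => by simp [hy])

/-- The difference `K ⋆ f - f` is a `K`-average of translation differences of `f`; Jensen pointwise
and Tonelli bound its norm by the largest of theirs over the support of `K`. -/
theorem eLpNorm_moll_sub_le {K : EuclideanSpace ℝ (Fin N) → ℝ} {ε : ℝ}
    (hK : IsMollifier K ε) {q : ℝ} (hq : 1 ≤ q) {f : EuclideanSpace ℝ (Fin N) → ℝ}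
    (hfm : Measurable f) (hf : MemLp f (ENNReal.ofReal q) volume) {C : ℝ≥0∞}
    (hC : ∀ t, ‖t‖ < ε → eLpNorm (fun x => f (x - t) - f x) (ENNReal.ofReal q) volume ≤ C) :
    eLpNorm (moll K f - f) (ENNReal.ofReal q) volume ≤ C := by
  have hq0 : 0 < q := by positivity
  have hqne : ENNReal.ofReal q ≠ 0 := by simpa using hq0
  have hq1 : 1 ≤ ENNReal.ofReal q := by simpa using hq
  have hli : LocallyIntegrable f volume := hf.locallyIntegrable hq1
  have hmeas : Measurable (Function.uncurry fun x t : EuclideanSpace ℝ (Fin N) =>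
      ENNReal.ofReal (K t) * ‖f (x - t) - f x‖ₑ ^ q) := by
    refine Measurable.mul (hK.test.continuous.measurable.comp measurable_snd).ennreal_ofReal ?_
    refine Measurable.pow_const (Measurable.enorm ?_) q
    exact (hfm.comp (measurable_fst.sub measurable_snd)).sub (hfm.comp measurable_fst)
  have hpow : ∀ t, ‖t‖ < ε → ∫⁻ x, ‖f (x - t) - f x‖ₑ ^ q ≤ C ^ q := by
    intro t ht
    have := hC t ht
    rw [eLpNorm_eq_lintegral_rpow_enorm_toReal hqne ENNReal.ofReal_ne_top,
      ENNReal.toReal_ofReal hq0.le] at this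
    have h2 := ENNReal.rpow_le_rpow this hq0.le
    rwa [← ENNReal.rpow_mul, one_div, inv_mul_cancel₀ hq0.ne', ENNReal.rpow_one] at h2
  rw [eLpNorm_eq_lintegral_rpow_enorm_toReal hqne ENNReal.ofReal_ne_top,
      ENNReal.toReal_ofReal hq0.le, one_div, ENNReal.rpow_inv_le_iff hq0]
  calc ∫⁻ x, ‖(moll K f - f) x‖ₑ ^ q
      ≤ ∫⁻ x, ∫⁻ t, ENNReal.ofReal (K t) * ‖f (x - t) - f x‖ₑ ^ q := by
        refine lintegral_mono fun x => ?_
        have hgm : Measurable fun t => f (x - t) - f x :=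
          (hfm.comp (measurable_const.sub measurable_id)).sub_const _
        refine le_trans ?_ (rpow_lintegral_kernel_le hK hq hgm)
        gcongr
        rw [Pi.sub_apply, moll_sub_eq hK hli]
        refine (enorm_integral_le_lintegral_enorm _).trans (lintegral_mono fun t => ?_)
        rw [enorm_mul, Real.enorm_of_nonneg (hK.nonneg t)]
    _ = ∫⁻ t, ∫⁻ x, ENNReal.ofReal (K t) * ‖f (x - t) - f x‖ₑ ^ q :=
        lintegral_lintegral_swap hmeas.aemeasurable
    _ ≤ ∫⁻ t, ENNReal.ofReal (K t) * C ^ q := by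
        refine lintegral_mono fun t => ?_
        rw [lintegral_const_mul' _ _ ENNReal.ofReal_ne_top]
        rcases le_or_gt ε ‖t‖ with h | h
        · simp [hK.eq_zero t h]
        · gcongr; exact hpow t h
    _ = C ^ q := by
        rw [lintegral_mul_const _ hK.test.continuous.measurable.ennreal_ofReal,
          ← ofReal_integral_eq_lintegral_ofReal hK.test.integrable (ae_of_all _ hK.nonneg),
          hK.integral_one, ENNReal.ofReal_one, one_mul]

theorem tendsto_eLpNorm_moll_sub {K : ℕ → EuclideanSpace ℝ (Fin N) → ℝ} {ε : ℕ → ℝ}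
    (hK : ∀ n, IsMollifier (K n) (ε n)) (hε : Tendsto ε atTop (𝓝 0)) {q : ℝ} (hq : 1 ≤ q)
    {f : EuclideanSpace ℝ (Fin N) → ℝ} (hf : MemLp f (ENNReal.ofReal q) volume) :
    Tendsto (fun n => eLpNorm (moll (K n) f - f) (ENNReal.ofReal q) volume) atTop (𝓝 0) := by
  -- Tonelli needs joint measurability of the translation differences; mollification does not see a
  -- change of `f` on a null set.
  wlog hfm : Measurable f generalizing f
  · obtain ⟨g, hg, hfg⟩ := hf.1.aemeasurable
    have := this (hf.ae_eq hfg) hg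
    refine this.congr fun n => ?_
    rw [moll_congr hfg]
    exact eLpNorm_congr_ae (EventuallyEq.rfl.sub hfg.symm)
  have : Fact (1 ≤ ENNReal.ofReal q) := ⟨by simpa using hq⟩
  have h1 := tendsto_eLpNorm_translate ENNReal.ofReal_ne_top hf
  rw [ENNReal.tendsto_nhds_zero] at h1 ⊢
  intro δ hδ
  obtain ⟨r, hr, hrt⟩ := Metric.eventually_nhds_iff.1 (h1 δ hδ)
  filter_upwards [hε.eventually_lt_const hr] with n hn
  exact eLpNorm_moll_sub_le (hK n) hq hfm hf fun t ht => hrt (by simpa using ht.trans hn)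

/-! ### Anisotropic cutoff functions -/

/-- The cutoff function `∏ χ(s_j x_j)`. -/
noncomputable def boxCutoff (χ : ℝ → ℝ) (s : Fin N → ℝ) (x : EuclideanSpace ℝ (Fin N)) : ℝ :=
  ∏ j, χ (x j * s j)

/-- The box `∏ [-r_j, r_j]`. -/
def box (r : Fin N → ℝ) : Set (EuclideanSpace ℝ (Fin N)) :=
  WithLp.ofLp ⁻¹' Set.Icc (-r) r

theorem isCompact_box (r : Fin N → ℝ) : IsCompact (box r) :=
  (PiLp.homeomorph 2 (fun _ : Fin N => ℝ)).isCompact_preimage.2 isCompact_Icc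

theorem volume_box {r : Fin N → ℝ} : volume (box r) = ∏ j, ENNReal.ofReal (2 * r j) := by
  rw [box, (PiLp.volume_preserving_ofLp (Fin N)).measure_preimage
    measurableSet_Icc.nullMeasurableSet, Real.volume_Icc_pi]
  congr 1; ext j; congr 1; simp; ring

theorem hasFDerivAt_boxCutoff {χ : ℝ → ℝ} (hχ : Differentiable ℝ χ) (s : Fin N → ℝ)
    (x : EuclideanSpace ℝ (Fin N)) :
    HasFDerivAt (boxCutoff χ s) (∑ i, (∏ j ∈ Finset.univ.erase i, χ (x j * s j)) •
      ((deriv χ (x i * s i) * s i) • (EuclideanSpace.proj i :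
        EuclideanSpace ℝ (Fin N) →L[ℝ] ℝ))) x := by
  refine HasFDerivAt.finsetProd fun i _ => ?_
  have h1 : HasFDerivAt (fun x : EuclideanSpace ℝ (Fin N) => x i * s i)
      (s i • (EuclideanSpace.proj i : EuclideanSpace ℝ (Fin N) →L[ℝ] ℝ)) x :=
    (EuclideanSpace.proj (𝕜 := ℝ) i : EuclideanSpace ℝ (Fin N) →L[ℝ] ℝ).hasFDerivAt.mul_const (s i)
  have h2 := (hχ (x i * s i)).hasDerivAt.comp_hasFDerivAt x h1
  rw [smul_smul] at h2
  exact h2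

theorem pderiv_boxCutoff {χ : ℝ → ℝ} (hχ : Differentiable ℝ χ) (s : Fin N → ℝ)
    (x : EuclideanSpace ℝ (Fin N)) (i : Fin N) :
    pderiv i (boxCutoff χ s) x =
      (∏ j ∈ Finset.univ.erase i, χ (x j * s j)) * (deriv χ (x i * s i) * s i) := by
  rw [pderiv, (hasFDerivAt_boxCutoff hχ s x).fderiv, _root_.sum_apply,
    Finset.sum_eq_single i]
  · simp
  · intro j _ hj
    simp [hj]
  · simp

/-- Stretching the `j`-th direction by `(n + 1) ^ a j` gives a box of volume of order `n + 1`, as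
the `a j` sum to one. The factor `(n + 1) ^ (-a i)` coming from the derivative then cancels the
`L^{1 / a i}` norm of the indicator of the box exactly. -/
theorem exists_cutoff (a : Fin N → ℝ) (ha : ∀ i, 0 < a i) (hsum : ∑ i, a i = 1) :
    ∃ η : ℕ → EuclideanSpace ℝ (Fin N) → ℝ,
      (∀ n, IsTest (η n)) ∧ (∀ n x, 0 ≤ η n x ∧ η n x ≤ 1) ∧
      (∀ R, ∀ᶠ n in atTop, ∀ x, ‖x‖ < R → η n x = 1) ∧
      ∃ B : ℝ≥0∞, B ≠ ⊤ ∧ ∀ i n, eLpNorm (pderiv i (η n)) (ENNReal.ofReal (a i)⁻¹) volume ≤ B := by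
  let χ : ContDiffBump (0 : ℝ) := ⟨1, 2, one_pos, one_lt_two⟩
  have hχd : Differentiable ℝ χ := (χ.contDiff (n := 1)).differentiable (by simp)
  obtain ⟨B₁, hB₁⟩ : ∃ B₁, ∀ t, ‖deriv χ t‖ ≤ B₁ :=
    χ.hasCompactSupport.deriv.exists_bound_of_continuous
      ((χ.contDiff (n := 1)).continuous_deriv le_rfl)
  have hB₁0 : 0 ≤ B₁ := (norm_nonneg _).trans (hB₁ 0)
  let s : ℕ → Fin N → ℝ := fun n j => ((n : ℝ) + 1) ^ (-a j)
  have hn0 : ∀ n : ℕ, (0 : ℝ) < (n : ℝ) + 1 := fun n => by positivity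
  have hs : ∀ n j, 0 < s n j := fun n j => Real.rpow_pos_of_pos (hn0 n) _
  have hsupp : ∀ n, Function.support (boxCutoff χ (s n)) ⊆ box fun j => 2 * (s n j)⁻¹ := by
    intro n x hx
    have h1 : ∀ j, |x j| ≤ 2 * (s n j)⁻¹ := by
      intro j
      have h2 : χ (x j * s n j) ≠ 0 := fun h =>
        hx (Finset.prod_eq_zero (Finset.mem_univ j) h)
      have h3 : x j * s n j ∈ Metric.ball (0 : ℝ) 2 := by
        rw [← χ.support_eq]; exact h2
      rw [Metric.mem_ball, dist_zero_right, Real.norm_eq_abs, abs_mul, abs_of_pos (hs n j),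
        ← lt_div_iff₀ (hs n j)] at h3
      exact h3.le
    exact ⟨fun j => (abs_le.1 (h1 j)).1, fun j => (abs_le.1 (h1 j)).2⟩
  have hts : ∀ n, tsupport (boxCutoff χ (s n)) ⊆ box fun j => 2 * (s n j)⁻¹ := fun n =>
    closure_minimal (hsupp n) (isCompact_box _).isClosed
  have htest : ∀ n, IsTest (boxCutoff χ (s n)) := by
    refine fun n => ⟨?_, HasCompactSupport.of_support_subset_isCompact (isCompact_box _) (hsupp n)⟩
    refine contDiff_prod fun j _ => χ.contDiff.comp (ContDiff.mul ?_ contDiff_const)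
    exact (EuclideanSpace.proj (𝕜 := ℝ) j : EuclideanSpace ℝ (Fin N) →L[ℝ] ℝ).contDiff
  have ha1 : ∀ i, a i ≤ 1 := fun i => by
    rw [← hsum]; exact Finset.single_le_sum (fun j _ => (ha j).le) (Finset.mem_univ i)
  refine ⟨fun n => boxCutoff χ (s n), htest, fun n x => ⟨Finset.prod_nonneg fun j _ => χ.nonneg,
    Finset.prod_le_one (fun j _ => χ.nonneg) fun j _ => χ.le_one⟩, fun R => ?_,
    ENNReal.ofReal (B₁ * 4 ^ (N : ℝ)), ENNReal.ofReal_ne_top, fun i n => ?_⟩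
  · have h1 : ∀ j, Tendsto (fun n => R * s n j) atTop (𝓝 0) := by
      intro j
      have : Tendsto (fun n : ℕ => ((n : ℝ) + 1) ^ (-a j)) atTop (𝓝 0) :=
        (tendsto_rpow_neg_atTop (ha j)).comp
          (tendsto_natCast_atTop_atTop.atTop_add tendsto_const_nhds)
      simpa using this.const_mul R
    have h2 : ∀ᶠ n in atTop, ∀ j, R * s n j < 1 :=
      eventually_all.2 fun j => (h1 j).eventually_lt_const one_pos
    filter_upwards [h2] with n hn x hx
    refine Finset.prod_eq_one fun j _ => χ.one_of_mem_closedBall ?_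
    rw [Metric.mem_closedBall, dist_zero_right, Real.norm_eq_abs, abs_mul, abs_of_pos (hs n j)]
    have hxj : |x j| ≤ R := (PiLp.norm_apply_le x j).trans hx.le
    exact (mul_le_mul_of_nonneg_right hxj (hs n j).le).trans (hn j).le
  · have hbound : ∀ x, ‖pderiv i (boxCutoff χ (s n)) x‖ ≤
        ‖(box fun j => 2 * (s n j)⁻¹).indicator (fun _ => B₁ * s n i) x‖ := by
      intro x
      by_cases hx : x ∈ box fun j => 2 * (s n j)⁻¹
      · rw [Set.indicator_of_mem hx, pderiv_boxCutoff hχd, norm_mul, norm_mul,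
          Real.norm_of_nonneg (mul_nonneg hB₁0 (hs n i).le), Real.norm_of_nonneg (hs n i).le]
        have h3 : ‖∏ j ∈ Finset.univ.erase i, χ (x j * s n j)‖ ≤ 1 := by
          rw [Real.norm_of_nonneg (Finset.prod_nonneg fun j _ => χ.nonneg)]
          exact Finset.prod_le_one (fun j _ => χ.nonneg) fun j _ => χ.le_one
        have h4 : ‖deriv χ (x i * s n i)‖ * s n i ≤ B₁ * s n i :=
          mul_le_mul_of_nonneg_right (hB₁ _) (hs n i).le
        calc _ ≤ 1 * (‖deriv χ (x i * s n i)‖ * s n i) :=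
              mul_le_mul_of_nonneg_right h3 (mul_nonneg (norm_nonneg _) (hs n i).le)
          _ ≤ _ := by rw [one_mul]; exact h4
      · have : x ∉ tsupport (boxCutoff χ (s n)) := fun h => hx (hts n h)
        have h0 : fderiv ℝ (boxCutoff χ (s n)) x = 0 :=
          Function.notMem_support.1 fun h => this (support_fderiv_subset ℝ h)
        simp [pderiv, h0]
    refine (eLpNorm_mono hbound).trans ?_
    have hai : 0 < (a i)⁻¹ := inv_pos.2 (ha i)
    rw [eLpNorm_indicator_const (isCompact_box _).measurableSet (by simpa using ha i)
      ENNReal.ofReal_ne_top, volume_box, ENNReal.toReal_ofReal hai.le, one_div, inv_inv,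
      Real.enorm_of_nonneg (mul_nonneg hB₁0 (hs n i).le),
      ← ENNReal.ofReal_prod_of_nonneg fun j _ => by have := hs n j; positivity]
    -- The volume of the box: its half-sides are `2 / s n j`, hence the factor `4` in each
    -- direction.
    have hprod : ∏ j, 2 * (2 * (s n j)⁻¹) = 4 ^ (N : ℝ) * ((n : ℝ) + 1) := by
      have : ∀ j, 2 * (2 * (s n j)⁻¹) = 4 * ((n : ℝ) + 1) ^ a j := fun j => by
        simp only [s]; rw [← Real.rpow_neg (hn0 n).le, neg_neg]; ring
      simp_rw [this]
      rw [Finset.prod_mul_distrib, Finset.prod_const, Finset.card_univ, Fintype.card_fin,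
        ← Real.rpow_sum_of_pos (hn0 n), hsum, Real.rpow_one, Real.rpow_natCast]
    rw [hprod, ENNReal.ofReal_rpow_of_nonneg (by positivity) (ha i).le,
      ← ENNReal.ofReal_mul (mul_nonneg hB₁0 (hs n i).le)]
    refine ENNReal.ofReal_le_ofReal ?_
    rw [Real.mul_rpow (by positivity) (hn0 n).le]
    have h5 : s n i * ((n : ℝ) + 1) ^ a i = 1 := by
      simp only [s]; rw [← Real.rpow_add (hn0 n)]; simp
    calc B₁ * s n i * (((4 : ℝ) ^ (N : ℝ)) ^ a i * ((n : ℝ) + 1) ^ a i)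
        = B₁ * ((4 : ℝ) ^ (N : ℝ)) ^ a i * (s n i * ((n : ℝ) + 1) ^ a i) := by ring
      _ ≤ B₁ * 4 ^ (N : ℝ) := by
        rw [h5, mul_one]
        refine mul_le_mul_of_nonneg_left ?_ hB₁0
        refine Real.rpow_le_self_of_one_le ?_ (ha1 i)
        exact Real.one_le_rpow (by norm_num) (by positivity)

/-! ### Auxiliary convergence results -/

/-- Dominated convergence. It serves both for the tail cut off by `η n` and for the part of `u` on
the support of `∂_i (η n)`. -/
theorem tendsto_eLpNorm_mul_of_tendsto_zero {q : ℝ} (hq : 0 < q)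
    {f : EuclideanSpace ℝ (Fin N) → ℝ} (hf : MemLp f (ENNReal.ofReal q) volume)
    {θ : ℕ → EuclideanSpace ℝ (Fin N) → ℝ} (hm : ∀ n, Measurable (θ n))
    (h1 : ∀ n x, |θ n x| ≤ 1) (h0 : ∀ x, ∀ᶠ n in atTop, θ n x = 0) :
    Tendsto (fun n => eLpNorm (fun x => θ n x * f x) (ENNReal.ofReal q) volume) atTop (𝓝 0) := by
  have hqne : ENNReal.ofReal q ≠ 0 := by simpa using hq
  simp_rw [eLpNorm_eq_lintegral_rpow_enorm_toReal hqne ENNReal.ofReal_ne_top,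
    ENNReal.toReal_ofReal hq.le]
  have hfin : ∫⁻ x, ‖f x‖ₑ ^ q ≠ ⊤ := by
    have := lintegral_rpow_enorm_lt_top_of_eLpNorm_lt_top hqne ENNReal.ofReal_ne_top hf.2
    rw [ENNReal.toReal_ofReal hq.le] at this
    exact this.ne
  have h2 : Tendsto (fun n => ∫⁻ x, ‖θ n x * f x‖ₑ ^ q) atTop (𝓝 (∫⁻ _ : EuclideanSpace ℝ (Fin N), 0)) := by
    refine tendsto_lintegral_of_dominated_convergence' (fun x => ‖f x‖ₑ ^ q)
      (fun n => ((hm n).aemeasurable.mul hf.1.aemeasurable).enorm.pow_const q)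
      (fun n => ae_of_all _ fun x => ?_) hfin (ae_of_all _ fun x => ?_)
    · refine ENNReal.rpow_le_rpow ?_ hq.le
      rw [enorm_mul]
      refine mul_le_of_le_one_left (zero_le) ?_
      rw [← ofReal_norm, Real.norm_eq_abs]
      exact ENNReal.ofReal_le_one.2 (h1 n x)
    · refine tendsto_const_nhds.congr' ?_
      filter_upwards [h0 x] with n hn
      simp [hn, hq]
  rw [lintegral_zero] at h2
  have h3 := (ENNReal.continuous_rpow_const (y := 1 / q)).tendsto 0 |>.comp h2
  rw [ENNReal.zero_rpow_of_pos (by positivity)] at h3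
  exact h3

/-! ### Approximation by test functions -/

theorem IsTest.mul_contDiff {η v : EuclideanSpace ℝ (Fin N) → ℝ} (hη : IsTest η)
    (hv : ContDiff ℝ ∞ v) : IsTest fun x => η x * v x :=
  ⟨hη.1.mul hv, hη.2.mul_right⟩

theorem pderiv_mul {η v : EuclideanSpace ℝ (Fin N) → ℝ} (hη : ContDiff ℝ ∞ η)
    (hv : ContDiff ℝ ∞ v) (i : Fin N) (x : EuclideanSpace ℝ (Fin N)) :
    pderiv i (fun x => η x * v x) x = η x * pderiv i v x + pderiv i η x * v x := by
  rw [pderiv, fderiv_fun_mul (hη.differentiable (by simp) x) (hv.differentiable (by simp) x)]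
  simp [pderiv]; ring

theorem pderiv_eq_zero_of_ball {η : EuclideanSpace ℝ (Fin N) → ℝ} {R : ℝ}
    (h : ∀ x, ‖x‖ < R → η x = 1) (i : Fin N) {x : EuclideanSpace ℝ (Fin N)} (hx : ‖x‖ < R) :
    pderiv i η x = 0 := by
  have h1 : η =ᶠ[𝓝 x] fun _ => (1 : ℝ) := by
    filter_upwards [Metric.isOpen_ball.mem_nhds (show x ∈ Metric.ball 0 R by simpa using hx)]
      with y hy
    exact h y (by simpa using hy)
  rw [pderiv, h1.fderiv_eq]
  simp

theorem eLpNorm_mul_le_of_holder {a q r : ℝ} (ha : 0 < a) (hq : 0 < q) (hr : 1 / r = a + 1 / q)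
    {f g : EuclideanSpace ℝ (Fin N) → ℝ} (hf : AEStronglyMeasurable f volume)
    (hg : AEStronglyMeasurable g volume) :
    eLpNorm (fun x => f x * g x) (ENNReal.ofReal r) volume ≤
      eLpNorm f (ENNReal.ofReal a⁻¹) volume * eLpNorm g (ENNReal.ofReal q) volume := by
  have : Real.HolderTriple a⁻¹ q r :=
    ⟨by rw [inv_inv, ← one_div q, ← one_div r, hr], inv_pos.2 ha, hq⟩
  have := this.ennrealOfReal
  exact eLpNorm_smul_le_mul_eLpNorm (φ := f) hg hf

/-- The approximants are `η n * (K n ⋆ u)`. The mass estimate is stated for every `S` inside the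
first indices with one error sequence: singletons serve Troisi's product, the full set serves tight
convergence. -/
theorem exists_test_approx {N₁ : ℕ} {p : Fin N → ℝ} {q : ℝ} (hq : 1 < q) (hp : ∀ i, 1 ≤ p i)
    (hp_one : ∀ i : Fin N, (i : ℕ) < N₁ → p i = 1)
    (hpq : ∀ i, p i < q) (hsum : ∑ i, (1 / p i - 1 / q) = 1)
    {u : EuclideanSpace ℝ (Fin N) → ℝ} (hu : MemLp u (ENNReal.ofReal q) volume) {D : Grad N}
    (hmeas : ∀ i ∈ firstIdx N N₁, HasMeasureDeriv u i (D.meas i))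
    (hfunL : ∀ i ∈ lastIdx N N₁, MemLp (D.func i) (ENNReal.ofReal (p i)) volume)
    (hfun : ∀ i ∈ lastIdx N N₁, HasWeakDeriv u i (D.func i)) :
    ∃ us : ℕ → EuclideanSpace ℝ (Fin N) → ℝ, (∀ n, IsTest (us n)) ∧
      Tendsto (fun n => eLpNorm (us n - u) (ENNReal.ofReal q) volume) atTop (𝓝 0) ∧
      (∀ i ∈ lastIdx N N₁, Tendsto (fun n => eLpNorm (pderiv i (us n) - D.func i)
        (ENNReal.ofReal (p i)) volume) atTop (𝓝 0)) ∧
      (∀ i ∈ firstIdx N N₁, Vague (fun n => (testGrad (us n)).meas i) (D.meas i)) ∧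
      ∃ ε : ℕ → ℝ≥0∞, Tendsto ε atTop (𝓝 0) ∧ ∀ S ⊆ firstIdx N N₁, ∀ n,
        totalMass S (testGrad (us n)).meas ≤ totalMass S D.meas + ε n := by
  have hq0 : 0 < q := by linarith
  have hp0 : ∀ i, 0 < p i := fun i => by linarith [hp i]
  have hq1 : 1 ≤ ENNReal.ofReal q := by simpa using hq.le
  have hp1 : ∀ i, 1 ≤ ENNReal.ofReal (p i) := fun i => by simpa using hp i
  have huL : LocallyIntegrable u volume := hu.locallyIntegrable hq1
  obtain ⟨η, hη, hη01, hηR, B, hB, hηB⟩ := exists_cutoff (fun i => 1 / p i - 1 / q)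
    (fun i => sub_pos.2 (one_div_lt_one_div_of_lt (hp0 i) (hpq i))) hsum
  have hε0 : ∀ n : ℕ, (0 : ℝ) < 1 / ((n : ℝ) + 1) := fun n => by positivity
  choose K hK using fun n : ℕ => exists_isMollifier (N := N) (hε0 n)
  have hεt : Tendsto (fun n : ℕ => 1 / ((n : ℝ) + 1)) atTop (𝓝 0) :=
    tendsto_one_div_add_atTop_nhds_zero_nat
  have hvs : ∀ n, ContDiff ℝ ∞ (moll (K n) u) := fun n => contDiff_moll (hK n).test huL
  have hηabs : ∀ n x, |η n x| ≤ 1 := fun n x => abs_le.2 ⟨by linarith [(hη01 n x).1], (hη01 n x).2⟩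
  -- the function `θ n` vanishes on larger and larger balls
  have hηfar : ∀ x, ∀ᶠ n in atTop, η n x = 1 := fun x => by
    filter_upwards [hηR (‖x‖ + 1)] with n hn
    exact hn x (by linarith)
  have hcut : ∀ {r : ℝ}, 0 < r → ∀ {f : EuclideanSpace ℝ (Fin N) → ℝ},
      MemLp f (ENNReal.ofReal r) volume →
      Tendsto (fun n => eLpNorm (fun x => (η n x - 1) * f x) (ENNReal.ofReal r) volume)
        atTop (𝓝 0) := by
    intro r hr f hf
    refine tendsto_eLpNorm_mul_of_tendsto_zero hr hf
      (fun n => ((hη n).continuous.sub continuous_const).measurable) (fun n x => ?_) (fun x => ?_)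
    · rw [abs_le]; constructor <;> linarith [(hη01 n x).1, (hη01 n x).2]
    · filter_upwards [hηfar x] with n hn
      simp [hn]
  have hconv : ∀ {r : ℝ}, 1 ≤ r → ∀ {f : EuclideanSpace ℝ (Fin N) → ℝ},
      MemLp f (ENNReal.ofReal r) volume →
      Tendsto (fun n => eLpNorm (fun x => η n x * moll (K n) f x - f x) (ENNReal.ofReal r) volume)
        atTop (𝓝 0) := by
    intro r hr f hf
    have hr1 : 1 ≤ ENNReal.ofReal r := by simpa using hr
    have h1 := tendsto_eLpNorm_moll_sub hK hεt hr hf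
    have h2 := hcut (zero_lt_one.trans_le hr) hf
    have h3 := h1.add h2
    rw [add_zero] at h3
    have hmc : ∀ n, Continuous (moll (K n) f) := fun n =>
      (contDiff_moll (hK n).test (hf.locallyIntegrable hr1)).continuous
    refine tendsto_of_tendsto_of_tendsto_of_le_of_le tendsto_const_nhds h3 (fun n => zero_le)
      fun n => ?_
    have heq : (fun x => η n x * moll (K n) f x - f x) =
        (fun x => η n x * (moll (K n) f - f) x) + fun x => (η n x - 1) * f x := by
      ext x; simp only [Pi.sub_apply, Pi.add_apply]; ring
    rw [heq]
    refine (eLpNorm_add_le ?_ ?_ hr1).trans (add_le_add_left (eLpNorm_mono fun x => ?_) _)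
    · exact (hη n).continuous.aestronglyMeasurable.mul
        ((hmc n).aestronglyMeasurable.sub hf.1)
    · exact ((hη n).continuous.sub continuous_const).aestronglyMeasurable.mul hf.1
    · rw [norm_mul]
      exact mul_le_of_le_one_left (norm_nonneg _) (hηabs n x)
  have herr : ∀ i, Tendsto (fun n => eLpNorm (fun x => pderiv i (η n) x * moll (K n) u x)
      (ENNReal.ofReal (p i)) volume) atTop (𝓝 0) := by
    intro i
    -- Multiplying by the indicator of the support of `∂_i (η n)` changes nothing in the product,
    -- but makes the remaining factor `θ n * u` tend to zero in `L^q`; Hölder then only needs `∂_i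
    -- (η n)` to be bounded in `L^{1 / a i}`.
    let θ : ℕ → EuclideanSpace ℝ (Fin N) → ℝ := fun n =>
      (Function.support (pderiv i (η n))).indicator fun _ => 1
    have hpc : ∀ n, Continuous (pderiv i (η n)) := fun n => ((hη n).contDiff_pderiv i).continuous
    have hθm : ∀ n, Measurable (θ n) := fun n =>
      measurable_const.indicator (measurableSet_support (hpc n).measurable)
    have hθ : Tendsto (fun n => eLpNorm (fun x => θ n x * u x) (ENNReal.ofReal q) volume)
        atTop (𝓝 0) := by
      refine tendsto_eLpNorm_mul_of_tendsto_zero hq0 hu hθm (fun n x => ?_) (fun x => ?_)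
      · by_cases h : x ∈ Function.support (pderiv i (η n)) <;> simp [θ, h]
      · filter_upwards [hηR (‖x‖ + 1)] with n hn
        have := pderiv_eq_zero_of_ball hn i (x := x) (by linarith)
        simp [θ, this]
    have h3 := (ENNReal.Tendsto.const_mul (tendsto_eLpNorm_moll_sub hK hεt hq.le hu)
      (Or.inr hB)).add (ENNReal.Tendsto.const_mul hθ (Or.inr hB))
    rw [mul_zero, add_zero] at h3
    refine tendsto_of_tendsto_of_tendsto_of_le_of_le tendsto_const_nhds h3 (fun n => zero_le)
      fun n => ?_
    have hai : (0 : ℝ) < 1 / p i - 1 / q :=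
      sub_pos.2 (one_div_lt_one_div_of_lt (hp0 i) (hpq i))
    have heq : (fun x => pderiv i (η n) x * moll (K n) u x) =
        (fun x => pderiv i (η n) x * (moll (K n) u - u) x) +
          fun x => pderiv i (η n) x * (θ n x * u x) := by
      ext x
      by_cases h : pderiv i (η n) x = 0
      · simp [h]
      · simp only [θ, Pi.add_apply, Pi.sub_apply, Set.indicator_of_mem (Function.mem_support.2 h)]
        ring
    have hm1 : AEStronglyMeasurable (moll (K n) u - u) volume :=
      (hvs n).continuous.aestronglyMeasurable.sub hu.1
    have hm2 : AEStronglyMeasurable (fun x => θ n x * u x) volume :=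
      (hθm n).aestronglyMeasurable.mul hu.1
    rw [heq]
    refine (eLpNorm_add_le ((hpc n).aestronglyMeasurable.mul hm1)
      ((hpc n).aestronglyMeasurable.mul hm2) (hp1 i)).trans (add_le_add ?_ ?_)
    · exact (eLpNorm_mul_le_of_holder hai hq0 (by ring) (hpc n).aestronglyMeasurable hm1).trans
        (mul_le_mul_left (hηB i n) _)
    · exact (eLpNorm_mul_le_of_holder hai hq0 (by ring) (hpc n).aestronglyMeasurable hm2).trans
        (mul_le_mul_left (hηB i n) _)
  have hus : ∀ n, IsTest fun x => η n x * moll (K n) u x := fun n => (hη n).mul_contDiff (hvs n)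
  have hpd : ∀ n i x, pderiv i (fun x => η n x * moll (K n) u x) x =
      η n x * pderiv i (moll (K n) u) x + pderiv i (η n) x * moll (K n) u x := fun n i x =>
    pderiv_mul (hη n).1 (hvs n) i x
  -- the pairing with a continuous function of compact support
  have hpair : ∀ i ∈ firstIdx N N₁, ∀ n, ∀ ζ : EuclideanSpace ℝ (Fin N) → ℝ, Continuous ζ →
      HasCompactSupport ζ →
      ∫ᵛ x, ζ x ∂<•((testGrad fun x => η n x * moll (K n) u x).meas i) =
        ∫ᵛ x, moll (K n) (fun y => η n y * ζ y) x ∂<•(D.meas i) +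
          ∫ x, ζ x * (pderiv i (η n) x * moll (K n) u x) := by
    intro i hi n ζ hζ hs
    have hζη : Continuous fun y => η n y * ζ y := (hη n).continuous.mul hζ
    have hvc : Continuous (pderiv i (moll (K n) u)) :=
      ((hvs n).fderiv_right (m := ∞) (by simp)).continuous.clm_apply continuous_const
    rw [vintegral_testGrad (hus n) hζ hs,
      ← (hmeas i hi).integral_mul_pderiv_moll (hK n) huL hζη hs.mul_left, ← integral_add]
    · congr 1; ext x; rw [hpd]; ring
    · exact (hζη.mul hvc).integrable_of_hasCompactSupport hs.mul_left.mul_right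
    · exact (hζ.mul (((hη n).contDiff_pderiv i).continuous.mul
        (hvs n).continuous)).integrable_of_hasCompactSupport hs.mul_right
  refine ⟨fun n x => η n x * moll (K n) u x, hus, hconv hq.le hu, fun i hi => ?_,
    fun i hi ζ hζ hs => ?_,
    fun n => ∑ i ∈ firstIdx N N₁, eLpNorm (fun x => pderiv i (η n) x * moll (K n) u x)
      (ENNReal.ofReal (p i)) volume, ?_, fun S hS n => ?_⟩
  · have h3 := (hconv (hp i) (hfunL i hi)).add (herr i)
    rw [add_zero] at h3
    refine tendsto_of_tendsto_of_tendsto_of_le_of_le tendsto_const_nhds h3 (fun n => zero_le)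
      fun n => ?_
    have heq : pderiv i (fun x => η n x * moll (K n) u x) - D.func i =
        (fun x => η n x * moll (K n) (D.func i) x - D.func i x) +
          fun x => pderiv i (η n) x * moll (K n) u x := by
      ext x
      simp only [Pi.sub_apply, Pi.add_apply]
      rw [hpd, (hfun i hi).pderiv_moll (hK n).test huL]; ring
    rw [heq]
    refine eLpNorm_add_le ?_ ?_ (hp1 i)
    · exact ((hη n).continuous.aestronglyMeasurable.mul
        (contDiff_moll (hK n).test
          ((hfunL i hi).locallyIntegrable (hp1 i))).continuous.aestronglyMeasurable).sub
        (hfunL i hi).1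
    · exact (((hη n).contDiff_pderiv i).continuous.mul (hvs n).continuous).aestronglyMeasurable
  · obtain ⟨C, hC⟩ := exists_abs_le_of_hasCompactSupport hζ hs
    obtain ⟨R, hR⟩ := hs.isCompact.isBounded.exists_norm_le
    have h1 : Tendsto (fun n => ∫ᵛ x, moll (K n) ζ x ∂<•(D.meas i)) atTop
        (𝓝 (∫ᵛ x, ζ x ∂<•(D.meas i))) :=
      VectorMeasure.tendsto_integral_filter_of_norm_le_const
        (Eventually.of_forall fun n =>
          (isTest_moll (hK n).test hζ hs).continuous.aestronglyMeasurable)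
        ⟨C, Eventually.of_forall fun n => ae_of_all _ fun x => abs_moll_le (hK n) hC x⟩
        (ae_of_all _ fun x => tendsto_moll_apply hK hεt hζ x)
    refine h1.congr' ?_
    -- Once the cutoff equals one on a ball containing the support of `ζ`, it disappears from the
    -- pairing together with its derivative.
    filter_upwards [hηR (R + 1)] with n hn
    have hball : ∀ x, ζ x ≠ 0 → ‖x‖ < R + 1 := fun x hx => by
      linarith [hR x (subset_tsupport _ hx)]
    have e1 : (fun y => η n y * ζ y) = ζ := by
      ext y
      by_cases hy : ζ y = 0
      · simp [hy]
      · rw [hn y (hball y hy), one_mul]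
    have e2 : ∀ x, ζ x * (pderiv i (η n) x * moll (K n) u x) = 0 := by
      intro y
      by_cases hy : ζ y = 0
      · simp [hy]
      · rw [pderiv_eq_zero_of_ball hn i (hball y hy)]; simp
    rw [hpair i hi n ζ hζ hs, e1]
    simp [e2]
  · have := tendsto_finsetSum (firstIdx N N₁) fun i _ => herr i
    simpa using this
  · refine totalMass_le fun ψ hψ => ?_
    have hsplit : ∑ i ∈ S, ∫ᵛ x, ψ i x ∂<•((testGrad fun x => η n x * moll (K n) u x).meas i) =
        ∑ i ∈ S, ∫ᵛ x, moll (K n) (fun y => η n y * ψ i y) x ∂<•(D.meas i) +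
          ∑ i ∈ S, ∫ x, ψ i x * (pderiv i (η n) x * moll (K n) u x) := by
      rw [← Finset.sum_add_distrib]
      exact Finset.sum_congr rfl fun i hi => hpair i (hS hi) n _ (hψ.1 i).1 (hψ.1 i).2
    rw [hsplit]
    refine ENNReal.ofReal_add_le.trans (add_le_add ?_ ?_)
    · have hU : (fun i y => η n y * ψ i y) ∈ UnitFields S := by
        refine ⟨fun i => ⟨(hη n).continuous.mul (hψ.1 i).1, (hψ.1 i).2.mul_left⟩, fun x => ?_⟩
        refine (Finset.sum_le_sum fun i _ => ?_).trans (hψ.2 x)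
        rw [mul_pow]
        exact mul_le_of_le_one_left (sq_nonneg _) ((sq_le_one_iff_abs_le_one _).2 (hηabs n x))
      exact le_totalMass D.meas (moll_mem_unitFields (hK n) hU)
    · refine (Finset.le_sum_of_subadditive ENNReal.ofReal ENNReal.ofReal_zero.le
        (fun _ _ => ENNReal.ofReal_add_le) S _).trans ?_
      refine (Finset.sum_le_sum fun i hi => ?_).trans
        (Finset.sum_le_sum_of_subset_of_nonneg hS fun _ _ _ => zero_le)
      -- For the first indices the cutoff error is measured in `L^1`, which is dual to the bound `|ψ
      -- i| ≤ 1`.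
      have hi1 : p i = 1 := hp_one i (by simpa [firstIdx] using hS hi)
      rw [hi1, ENNReal.ofReal_one, eLpNorm_one_eq_lintegral_enorm]
      refine (ENNReal.ofReal_le_ofReal (le_abs_self _)).trans ?_
      rw [← Real.norm_eq_abs, ofReal_norm]
      refine (enorm_integral_le_lintegral_enorm _).trans (lintegral_mono fun x => ?_)
      rw [enorm_mul]
      refine mul_le_of_le_one_left zero_le ?_
      rw [← ofReal_norm, Real.norm_eq_abs]
      exact ENNReal.ofReal_le_one.2 (UnitFields.abs_le_one hψ hi x)

/-! ### The inequality of Troisi for test functions -/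

/-- The fundamental theorem of calculus for `|f| ^ γ`. The exponent `γ = 1` is treated apart, since
the absolute value is not differentiable at zero. -/
theorem enorm_rpow_le_lintegral_deriv {f : ℝ → ℝ} (hf : ContDiff ℝ 1 f) (hs : HasCompactSupport f)
    {γ : ℝ} (hγ : 1 ≤ γ) (x : ℝ) :
    ‖f x‖ₑ ^ γ ≤ ∫⁻ t, ENNReal.ofReal γ * (‖f t‖ₑ ^ (γ - 1) * ‖deriv f t‖ₑ) := by
  rcases hγ.eq_or_lt with rfl | hγ
  · simp only [ENNReal.rpow_one, ENNReal.ofReal_one, sub_self, ENNReal.rpow_zero, one_mul]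
    exact (hs.enorm_le_lintegral_Ici_deriv hf x).trans
      (lintegral_mono' Measure.restrict_le_self le_rfl)
  · have hγ0 : 0 < γ := by linarith
    have h1 : ContDiff ℝ 1 (fun t => ‖f t‖ ^ γ) := hf.norm_rpow hγ
    have h2 : HasCompactSupport (fun t => ‖f t‖ ^ γ) := by
      refine hs.comp_left (g := fun y => ‖y‖ ^ γ) ?_
      simp [hγ0.ne']
    have h3 := h2.enorm_le_lintegral_Ici_deriv h1 x
    have h4 : ∀ y : ℝ, ‖‖f y‖ ^ γ‖ₑ = ‖f y‖ₑ ^ γ := fun y => by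
      rw [Real.enorm_rpow_of_nonneg (norm_nonneg _) hγ0.le, enorm_norm]
    rw [h4] at h3
    refine h3.trans ((lintegral_mono' Measure.restrict_le_self le_rfl).trans
      (lintegral_mono fun t => ?_))
    have h5 := norm_fderiv_norm_rpow_le (hf.differentiable one_ne_zero) (x := t) hγ
    rw [← norm_deriv_eq_norm_fderiv, ← norm_deriv_eq_norm_fderiv] at h5
    rw [← ofReal_norm]
    refine (ENNReal.ofReal_le_ofReal h5).trans (le_of_eq ?_)
    rw [ENNReal.ofReal_mul (by positivity), ENNReal.ofReal_mul hγ0.le,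
      ← ENNReal.ofReal_rpow_of_nonneg (norm_nonneg _) (by linarith), ofReal_norm, ofReal_norm,
      mul_assoc]


theorem ennreal_rpow_sum {ι : Type*} (a : ℝ≥0∞) (s : Finset ι) {f : ι → ℝ}
    (hf : ∀ i ∈ s, 0 ≤ f i) : a ^ ∑ i ∈ s, f i = ∏ i ∈ s, a ^ f i := by
  classical
  induction s using Finset.induction_on with
  | empty => simp
  | insert j s hj ih =>
    rw [Finset.sum_insert hj, Finset.prod_insert hj, ENNReal.rpow_add_of_nonneg _ _
      (hf j (Finset.mem_insert_self j s))
      (Finset.sum_nonneg fun i hi => hf i (Finset.mem_insert_of_mem hi)),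
      ih fun i hi => hf i (Finset.mem_insert_of_mem hi)]

/-- The Gagliardo–Nirenberg product inequality is available for one function; several are reduced to
it by dominating each `F i` by `c i * f`, where `f` is the sum of the normalised `F i / c i` and has
integral at most `N`. The power of `N` is the price. -/
theorem lintegral_prod_lintegral_rpow_le (hN : 2 ≤ N) {F : Fin N → (Fin N → ℝ) → ℝ≥0∞}
    (hF : ∀ i, Measurable (F i)) {c : Fin N → ℝ≥0∞} (hc0 : ∀ i, c i ≠ 0) (hc : ∀ i, c i ≠ ⊤)
    (hFc : ∀ i, ∫⁻ y, F i y ≤ c i) :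
    ∫⁻ y, ∏ i, (∫⁻ t, F i (Function.update y i t)) ^ (1 / ((N : ℝ) - 1)) ≤
      (∏ i, c i ^ (1 / ((N : ℝ) - 1))) * (N : ℝ≥0∞) ^ ((N : ℝ) / ((N : ℝ) - 1)) := by
  have hN1 : (1 : ℝ) < N := by exact_mod_cast hN
  have hs : 0 ≤ 1 / ((N : ℝ) - 1) := one_div_nonneg.2 (by linarith)
  let f : (Fin N → ℝ) → ℝ≥0∞ := fun y => ∑ i, (c i)⁻¹ * F i y
  have hf : Measurable f := Finset.measurable_sum _ fun i _ => (hF i).const_mul _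
  have hle : ∀ i y, F i y ≤ c i * f y := fun i y => by
    calc F i y = c i * ((c i)⁻¹ * F i y) := by
          rw [← mul_assoc, ENNReal.mul_inv_cancel (hc0 i) (hc i), one_mul]
      _ ≤ c i * f y := by
          gcongr
          exact Finset.single_le_sum (f := fun i => (c i)⁻¹ * F i y) (fun _ _ => zero_le)
            (Finset.mem_univ i)
  have hint : ∫⁻ y, f y ≤ N := by
    rw [lintegral_finsetSum _ fun i _ => (hF i).const_mul _]
    calc _ ≤ ∑ i : Fin N, (1 : ℝ≥0∞) := by
          refine Finset.sum_le_sum fun i _ => ?_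
          rw [lintegral_const_mul _ (hF i)]
          calc _ ≤ (c i)⁻¹ * c i := by gcongr; exact hFc i
            _ = 1 := ENNReal.inv_mul_cancel (hc0 i) (hc i)
      _ = N := by simp
  have hconj : Real.HolderConjugate (Fintype.card (Fin N)) ((N : ℝ) / ((N : ℝ) - 1)) := by
    rw [Fintype.card_fin]
    exact Real.HolderConjugate.conjExponent hN1
  calc ∫⁻ y, ∏ i, (∫⁻ t, F i (Function.update y i t)) ^ (1 / ((N : ℝ) - 1))
      ≤ ∫⁻ y, (∏ i, c i ^ (1 / ((N : ℝ) - 1))) *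
          ∏ i, (∫⁻ t, f (Function.update y i t)) ^ (1 / ((N : ℝ) - 1)) := by
        refine lintegral_mono fun y => ?_
        rw [← Finset.prod_mul_distrib]
        refine Finset.prod_le_prod' fun i _ => ?_
        rw [← ENNReal.mul_rpow_of_nonneg _ _ hs]
        refine ENNReal.rpow_le_rpow ?_ hs
        rw [← lintegral_const_mul' _ _ (hc i)]
        exact lintegral_mono fun t => hle i _
    _ = (∏ i, c i ^ (1 / ((N : ℝ) - 1))) *
          ∫⁻ y, ∏ i, (∫⁻ t, f (Function.update y i t)) ^ (1 / ((N : ℝ) - 1)) := by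
        rw [lintegral_const_mul']
        exact ENNReal.prod_ne_top fun i _ => ENNReal.rpow_ne_top_of_nonneg hs (hc i)
    _ ≤ _ := by
        gcongr
        have h := lintegral_prod_lintegral_pow_le (fun _ : Fin N => (volume : Measure ℝ)) hconj hf
        rw [Fintype.card_fin] at h
        exact h.trans (ENNReal.rpow_le_rpow hint (by have := hconj.symm.pos; exact this.le))

theorem contDiff_toLp_update (y : Fin N → ℝ) (i : Fin N) {n : ℕ∞} :
    ContDiff ℝ n fun t => (WithLp.toLp 2 (Function.update y i t) : EuclideanSpace ℝ (Fin N)) :=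
  (PiLp.continuousLinearEquiv 2 ℝ (fun _ : Fin N => ℝ)).symm.contDiff.comp (contDiff_update n y i)

theorem hasDerivAt_toLp_update (y : Fin N → ℝ) (i : Fin N) (t : ℝ) :
    HasDerivAt (fun t => (WithLp.toLp 2 (Function.update y i t) : EuclideanSpace ℝ (Fin N)))
      (EuclideanSpace.single i 1) t :=
  (PiLp.continuousLinearEquiv 2 ℝ (fun _ : Fin N => ℝ)).symm.toContinuousLinearMap.hasFDerivAt.comp_hasDerivAt
    t (hasDerivAt_update y i t)

theorem IsTest.enorm_rpow_le_lintegral {φ : EuclideanSpace ℝ (Fin N) → ℝ} (hφ : IsTest φ)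
    (i : Fin N) {γ : ℝ} (hγ : 1 ≤ γ) (y : Fin N → ℝ) :
    ‖φ (WithLp.toLp 2 y)‖ₑ ^ γ ≤ ∫⁻ t, ENNReal.ofReal γ *
      (‖φ (WithLp.toLp 2 (Function.update y i t))‖ₑ ^ (γ - 1) *
        ‖pderiv i φ (WithLp.toLp 2 (Function.update y i t))‖ₑ) := by
  let f : ℝ → ℝ := fun t => φ (WithLp.toLp 2 (Function.update y i t))
  have hf : ContDiff ℝ 1 f := (hφ.1.of_le (by simp)).comp (contDiff_toLp_update y i)
  have hs : HasCompactSupport f :=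
    hφ.2.comp_isClosedEmbedding ((PiLp.homeomorph 2 (fun _ : Fin N => ℝ)).symm.isClosedEmbedding.comp
      (isClosedEmbedding_update y i))
  have h := enorm_rpow_le_lintegral_deriv hf hs hγ (y i)
  have hd : ∀ t, deriv f t = pderiv i φ (WithLp.toLp 2 (Function.update y i t)) := fun t =>
    ((hφ.1.differentiable (by simp) _).hasFDerivAt.comp_hasDerivAt t
      (hasDerivAt_toLp_update y i t)).deriv
  simp only [hd] at h
  simpa [f] using h

theorem lintegral_toLp (F : EuclideanSpace ℝ (Fin N) → ℝ≥0∞) :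
    ∫⁻ y : Fin N → ℝ, F (WithLp.toLp 2 y) = ∫⁻ x, F x :=
  (PiLp.volume_preserving_toLp (Fin N)).lintegral_comp_emb
    (MeasurableEquiv.toLp 2 (Fin N → ℝ)).measurableEmbedding F

/-- Hölder with exponents `p` and its conjugate: the power of `f` is `q` divided by the conjugate
exponent, so only the `L^q` norm of `f` appears. For `p = 1` this power is zero. -/
theorem lintegral_rpow_mul_le {f g : EuclideanSpace ℝ (Fin N) → ℝ} (hf : Measurable f)
    (hg : Measurable g) {p q : ℝ} (hp : 1 ≤ p) (hq : 0 < q) :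
    ∫⁻ x, ‖f x‖ₑ ^ (q * (1 - 1 / p)) * ‖g x‖ₑ ≤
      eLpNorm f (ENNReal.ofReal q) volume ^ (q * (1 - 1 / p)) *
        eLpNorm g (ENNReal.ofReal p) volume := by
  rcases hp.eq_or_lt with rfl | hp1
  · simp [eLpNorm_one_eq_lintegral_enorm]
  have hp0 : 0 < p := by linarith
  have hpq := (Real.HolderConjugate.conjExponent hp1).symm
  have hr : 1 - 1 / p = (Real.conjExponent p)⁻¹ := by
    rw [Real.conjExponent]; field_simp
  rw [hr, eLpNorm_eq_lintegral_rpow_enorm_toReal (by simpa using hq) ENNReal.ofReal_ne_top,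
    eLpNorm_eq_lintegral_rpow_enorm_toReal (by simpa using hp0) ENNReal.ofReal_ne_top,
    ENNReal.toReal_ofReal hq.le, ENNReal.toReal_ofReal hp0.le]
  refine (ENNReal.lintegral_mul_le_Lp_mul_Lq volume hpq (hf.enorm.pow_const _).aemeasurable
    hg.enorm.aemeasurable).trans (le_of_eq ?_)
  have hc0 := hpq.pos
  simp_rw [← ENNReal.rpow_mul]
  congr 3
  · ext x; congr 1; field_simp
  · field_simp

theorem pow_le_of_rpow_le_prod {p : Fin N → ℝ} {q X : ℝ} (hN : 2 ≤ N) (hq : 0 < q)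
    (hsum : ∑ i, (1 / p i - 1 / q) = 1) {γ e : Fin N → ℝ}
    (hγ0 : ∀ i, 0 < γ i) (hX : 0 < X) (he : ∀ i, 0 < e i)
    (h : X ^ q ≤ (∏ i, (γ i * (X ^ (q * (1 - 1 / p i)) * e i)) ^ (1 / ((N : ℝ) - 1))) *
      (N : ℝ) ^ ((N : ℝ) / ((N : ℝ) - 1))) :
    X ^ (N : ℝ) ≤ (N : ℝ) ^ (N : ℝ) * (∏ i, γ i) * ∏ i, e i := by
  have hN1 : (0 : ℝ) < (N : ℝ) - 1 := by
    have : (2 : ℝ) ≤ N := by exact_mod_cast hN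
    linarith
  have hpos : ∀ i, 0 < γ i * (X ^ (q * (1 - 1 / p i)) * e i) := fun i =>
    mul_pos (hγ0 i) (mul_pos (Real.rpow_pos_of_pos hX _) (he i))
  have h1 := Real.rpow_le_rpow (by positivity) h hN1.le
  rw [Real.mul_rpow (Finset.prod_nonneg fun i _ => Real.rpow_nonneg (hpos i).le _) (by positivity),
    Real.finsetProd_rpow _ _ fun i _ => (hpos i).le, ← Real.rpow_mul (Finset.prod_nonneg fun i _ => (hpos i).le),
    ← Real.rpow_mul (Nat.cast_nonneg _), one_div_mul_cancel hN1.ne', div_mul_cancel₀ _ hN1.ne',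
    Real.rpow_one, Finset.prod_mul_distrib, Finset.prod_mul_distrib,
    ← Real.rpow_sum_of_pos hX, ← Real.rpow_mul hX.le] at h1
  -- After raising to the power `N - 1`, the right side carries `X ^ (q (N - 1) - N)` and the left
  -- side `X ^ (q (N - 1))`; dividing leaves `X ^ N`.
  have hexp : ∑ i, q * (1 - 1 / p i) = q * ((N : ℝ) - 1) - N := by
    rw [Finset.sum_sub_distrib, Finset.sum_const, Finset.card_univ, Fintype.card_fin,
      nsmul_eq_mul] at hsum
    rw [← Finset.mul_sum, Finset.sum_sub_distrib, Finset.sum_const, Finset.card_univ,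
      Fintype.card_fin, nsmul_eq_mul, mul_one]
    have : ∑ i, 1 / p i = 1 + N * (1 / q) := by linarith
    rw [this]; field_simp; ring
  rw [hexp, Real.rpow_sub hX] at h1
  have hXq : 0 < X ^ (q * ((N : ℝ) - 1)) := Real.rpow_pos_of_pos hX _
  have hXN : 0 < X ^ (N : ℝ) := Real.rpow_pos_of_pos hX _
  have h2 : X ^ (q * ((N : ℝ) - 1)) ≤ X ^ (q * ((N : ℝ) - 1)) *
      (((N : ℝ) ^ (N : ℝ) * (∏ i, γ i) * ∏ i, e i) / X ^ (N : ℝ)) := by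
    refine h1.trans (le_of_eq ?_); ring
  have h3 : 1 ≤ ((N : ℝ) ^ (N : ℝ) * (∏ i, γ i) * ∏ i, e i) / X ^ (N : ℝ) := by
    by_contra hcon
    push Not at hcon
    have := mul_lt_mul_of_pos_left hcon hXq
    linarith
  rwa [le_div_iff₀ hXN, one_mul] at h3

theorem IsTest.rpow_le_prod {p : Fin N → ℝ} {q : ℝ} (hN : 2 ≤ N) (hq : 0 < q) (hp : ∀ i, 1 ≤ p i)
    (hsum : ∑ i, (1 / p i - 1 / q) = 1) {γ e : Fin N → ℝ} (hγ : ∀ i, γ i = 1 + q * (1 - 1 / p i))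
    {φ : EuclideanSpace ℝ (Fin N) → ℝ} (hφ : IsTest φ) {X : ℝ} (hX : 0 < X)
    (hφX : eLpNorm φ (ENNReal.ofReal q) volume = ENNReal.ofReal X) (he : ∀ i, 0 < e i)
    (hφe : ∀ i, eLpNorm (pderiv i φ) (ENNReal.ofReal (p i)) volume ≤ ENNReal.ofReal (e i)) :
    X ^ (N : ℝ) ≤ (N : ℝ) ^ (N : ℝ) * (∏ i, γ i) * ∏ i, e i := by
  have hN1 : (0 : ℝ) < (N : ℝ) - 1 := by
    have : (2 : ℝ) ≤ N := by exact_mod_cast hN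
    linarith
  have hp0 : ∀ i, 0 < p i := fun i => by linarith [hp i]
  have hr0 : ∀ i, 0 ≤ q * (1 - 1 / p i) := fun i =>
    mul_nonneg hq.le (sub_nonneg.2 (by rw [div_le_one (hp0 i)]; exact hp i))
  have hγ1 : ∀ i, 1 ≤ γ i := fun i => by rw [hγ]; linarith [hr0 i]
  have hγ0 : ∀ i, 0 < γ i := fun i => by linarith [hγ1 i]
  have hγs : ∀ i, γ i - 1 = q * (1 - 1 / p i) := fun i => by rw [hγ]; ring
  refine pow_le_of_rpow_le_prod hN hq hsum hγ0 hX he ?_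
  have hcpos : ∀ i, 0 < γ i * (X ^ (q * (1 - 1 / p i)) * e i) := fun i =>
    mul_pos (hγ0 i) (mul_pos (Real.rpow_pos_of_pos hX _) (he i))
  have hφm : Measurable φ := hφ.continuous.measurable
  have hpm : ∀ i, Measurable (pderiv i φ) := fun i => (hφ.contDiff_pderiv i).continuous.measurable
  let G : Fin N → EuclideanSpace ℝ (Fin N) → ℝ≥0∞ := fun i x =>
    ENNReal.ofReal (γ i) * (‖φ x‖ₑ ^ (γ i - 1) * ‖pderiv i φ x‖ₑ)
  have hG : ∀ i, Measurable (G i) := fun i =>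
    ((hφm.enorm.pow_const _).mul (hpm i).enorm).const_mul _
  have htoLp : Measurable fun y : Fin N → ℝ => (WithLp.toLp 2 y : EuclideanSpace ℝ (Fin N)) :=
    (PiLp.volume_preserving_toLp (Fin N)).measurable
  have hGc : ∀ i, ∫⁻ y : Fin N → ℝ, G i (WithLp.toLp 2 y) ≤
      ENNReal.ofReal (γ i * (X ^ (q * (1 - 1 / p i)) * e i)) := by
    intro i
    rw [lintegral_toLp]
    simp only [G, hγs]
    rw [lintegral_const_mul' _ _ ENNReal.ofReal_ne_top, ENNReal.ofReal_mul (hγ0 i).le,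
      ENNReal.ofReal_mul (Real.rpow_nonneg hX.le _), ← ENNReal.ofReal_rpow_of_nonneg hX.le (hr0 i),
      ← hφX]
    gcongr
    exact (lintegral_rpow_mul_le hφm (hpm i) (hp i) hq).trans (by gcongr; exact hφe i)
  have hmain := lintegral_prod_lintegral_rpow_le hN (F := fun i y => G i (WithLp.toLp 2 y))
    (fun i => (hG i).comp htoLp)
    (c := fun i => ENNReal.ofReal (γ i * (X ^ (q * (1 - 1 / p i)) * e i)))
    (fun i => by simpa using hcpos i) (fun i => ENNReal.ofReal_ne_top) hGc
  have hleft : ENNReal.ofReal (X ^ q) ≤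
      ∫⁻ y : Fin N → ℝ, ∏ i, (∫⁻ t, G i (WithLp.toLp 2 (Function.update y i t))) ^
        (1 / ((N : ℝ) - 1)) := by
    have hXq : ENNReal.ofReal (X ^ q) = ∫⁻ y : Fin N → ℝ, ‖φ (WithLp.toLp 2 y)‖ₑ ^ q := by
      rw [lintegral_toLp (fun x => ‖φ x‖ₑ ^ q), ← ENNReal.ofReal_rpow_of_nonneg hX.le hq.le,
        ← hφX, eLpNorm_eq_lintegral_rpow_enorm_toReal (by simpa using hq) ENNReal.ofReal_ne_top,
        ENNReal.toReal_ofReal hq.le, ← ENNReal.rpow_mul, one_div_mul_cancel hq.ne',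
        ENNReal.rpow_one]
    rw [hXq]
    refine lintegral_mono fun y => ?_
    -- The `γ i` sum to `q (N - 1)`, so the product of the one-dimensional bounds recovers `|φ| ^
    -- q`.
    have hexp : ∑ i, γ i * (1 / ((N : ℝ) - 1)) = q := by
      rw [Finset.sum_sub_distrib, Finset.sum_const, Finset.card_univ, Fintype.card_fin,
        nsmul_eq_mul] at hsum
      have h1 : ∑ i, 1 / p i = 1 + N * (1 / q) := by linarith
      simp_rw [hγ]
      rw [← Finset.sum_mul, Finset.sum_add_distrib, ← Finset.mul_sum, Finset.sum_sub_distrib,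
        Finset.sum_const, Finset.card_univ, Fintype.card_fin, nsmul_eq_mul, mul_one, h1]
      field_simp; ring
    calc ‖φ (WithLp.toLp 2 y)‖ₑ ^ q
        = ∏ i, (‖φ (WithLp.toLp 2 y)‖ₑ ^ γ i) ^ (1 / ((N : ℝ) - 1)) := by
          simp_rw [← ENNReal.rpow_mul]
          rw [← hexp, ennreal_rpow_sum]
          exact fun i _ => mul_nonneg (hγ0 i).le (by positivity)
      _ ≤ _ := by
          refine Finset.prod_le_prod' fun i _ => ENNReal.rpow_le_rpow ?_ (by positivity)
          exact hφ.enorm_rpow_le_lintegral i (hγ1 i) y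
  have hfin := hleft.trans hmain
  have hN0 : (0 : ℝ) < N := by linarith
  have hright : (∏ i, ENNReal.ofReal (γ i * (X ^ (q * (1 - 1 / p i)) * e i)) ^
      (1 / ((N : ℝ) - 1))) * (N : ℝ≥0∞) ^ ((N : ℝ) / ((N : ℝ) - 1)) =
      ENNReal.ofReal ((∏ i, (γ i * (X ^ (q * (1 - 1 / p i)) * e i)) ^ (1 / ((N : ℝ) - 1))) *
        (N : ℝ) ^ ((N : ℝ) / ((N : ℝ) - 1))) := by
    rw [ENNReal.ofReal_mul (Finset.prod_nonneg fun i _ => Real.rpow_nonneg (hcpos i).le _),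
      ENNReal.ofReal_prod_of_nonneg fun i _ => Real.rpow_nonneg (hcpos i).le _,
      ← ENNReal.ofReal_rpow_of_pos hN0, ENNReal.ofReal_natCast]
    congr 1
    exact Finset.prod_congr rfl fun i _ => ENNReal.ofReal_rpow_of_pos (hcpos i)
  rw [hright] at hfin
  refine (ENNReal.ofReal_le_ofReal_iff ?_).1 hfin
  exact mul_nonneg (Finset.prod_nonneg fun i _ => Real.rpow_nonneg (hcpos i).le _) (by positivity)

theorem exists_troisi_test {p : Fin N → ℝ} {q : ℝ} (hN : 2 ≤ N) (hq : 0 < q) (hp : ∀ i, 1 ≤ p i)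
    (hsum : ∑ i, (1 / p i - 1 / q) = 1) :
    ∃ T₀ : ℝ, 0 < T₀ ∧ ∀ φ : EuclideanSpace ℝ (Fin N) → ℝ, IsTest φ →
      ENNReal.ofReal T₀ * eLpNorm φ (ENNReal.ofReal q) volume ≤
        ∏ i, eLpNorm (pderiv i φ) (ENNReal.ofReal (p i)) volume ^ (1 / (N : ℝ)) := by
  have hN0 : (0 : ℝ) < N := by exact_mod_cast (by omega : 0 < N)
  have hp0 : ∀ i, 0 < p i := fun i => by linarith [hp i]
  let γ : Fin N → ℝ := fun i => 1 + q * (1 - 1 / p i)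
  have hγ0 : ∀ i, 0 < γ i := fun i => by
    have : 0 ≤ q * (1 - 1 / p i) :=
      mul_nonneg hq.le (sub_nonneg.2 (by rw [div_le_one (hp0 i)]; exact hp i))
    simp only [γ]; linarith
  set A : ℝ := (N : ℝ) ^ (N : ℝ) * ∏ i, γ i with hA
  have hA0 : 0 < A := mul_pos (by positivity) (Finset.prod_pos fun i _ => hγ0 i)
  refine ⟨(A ^ (1 / (N : ℝ)))⁻¹, by positivity, fun φ hφ => ?_⟩
  set X := (eLpNorm φ (ENNReal.ofReal q) volume).toReal with hXdef
  have hφX : eLpNorm φ (ENNReal.ofReal q) volume = ENNReal.ofReal X :=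
    (ENNReal.ofReal_toReal (hφ.memLp _).2.ne).symm
  set d : Fin N → ℝ := fun i => (eLpNorm (pderiv i φ) (ENNReal.ofReal (p i)) volume).toReal
  have hd : ∀ i, eLpNorm (pderiv i φ) (ENNReal.ofReal (p i)) volume = ENNReal.ofReal (d i) :=
    fun i => (ENNReal.ofReal_toReal ((hφ.contDiff_pderiv i).memLp _).2.ne).symm
  have hd0 : ∀ i, 0 ≤ d i := fun i => ENNReal.toReal_nonneg
  rcases (show 0 ≤ X from ENNReal.toReal_nonneg).eq_or_lt with hX | hX
  · simp [hφX, ← hX]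
  -- The normalisation divides by the derivative norms, which might vanish; they are enlarged by
  -- `δ`, which is then sent to zero.
  have h1 : ∀ δ : ℝ, 0 < δ → X ^ (N : ℝ) ≤ A * ∏ i, (d i + δ) := fun δ hδ =>
    hφ.rpow_le_prod hN hq hp hsum (fun _ => rfl) hX hφX (fun i => by linarith [hd0 i])
      fun i => by rw [hd]; exact ENNReal.ofReal_le_ofReal (by linarith)
  have h2 : X ^ (N : ℝ) ≤ A * ∏ i, d i := by
    have hc : Continuous fun δ : ℝ => A * ∏ i, (d i + δ) := by fun_prop
    have ht : Tendsto (fun δ : ℝ => A * ∏ i, (d i + δ)) (𝓝[>] 0) (𝓝 (A * ∏ i, (d i + 0))) :=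
      (hc.tendsto 0).mono_left nhdsWithin_le_nhds
    simp only [add_zero] at ht
    exact ge_of_tendsto ht (eventually_nhdsWithin_of_forall fun δ hδ => h1 δ hδ)
  have h3 := Real.rpow_le_rpow (by positivity) h2 (by positivity : (0 : ℝ) ≤ 1 / N)
  rw [← Real.rpow_mul hX.le, mul_one_div_cancel hN0.ne', Real.rpow_one,
    Real.mul_rpow hA0.le (Finset.prod_nonneg fun i _ => hd0 i),
    ← Real.finsetProd_rpow _ _ fun i _ => hd0 i] at h3
  rw [hφX, ← ENNReal.ofReal_mul (by positivity)]
  calc ENNReal.ofReal ((A ^ (1 / (N : ℝ)))⁻¹ * X) ≤ ENNReal.ofReal (∏ i, d i ^ (1 / (N : ℝ))) := by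
        refine ENNReal.ofReal_le_ofReal ?_
        rwa [inv_mul_le_iff₀ (by positivity)]
    _ = _ := by
        rw [ENNReal.ofReal_prod_of_nonneg fun i _ => Real.rpow_nonneg (hd0 i) _]
        refine Finset.prod_congr rfl fun i _ => ?_
        rw [hd, ENNReal.ofReal_rpow_of_nonneg (hd0 i) (by positivity)]

/-! ### Weak compactness -/

open scoped CompactlySupported in
-- Bounded real sequences converge along an ultrafilter, which replaces diagonal extraction. The
-- limit functional is linear, and positive because the `g n` are nonnegative, so it is represented
-- by a regular measure.
theorem exists_measure_tendsto {g : ℕ → EuclideanSpace ℝ (Fin N) → ℝ} (hg0 : ∀ n x, 0 ≤ g n x)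
    (hg : ∀ n, LocallyIntegrable (g n) volume)
    (hb : ∀ f : EuclideanSpace ℝ (Fin N) → ℝ, Continuous f → HasCompactSupport f →
      ∃ C, ∀ n, |∫ x, f x * g n x| ≤ C) (𝒰 : Ultrafilter ℕ) :
    ∃ ν : Measure (EuclideanSpace ℝ (Fin N)), ν.Regular ∧
      ∀ f : EuclideanSpace ℝ (Fin N) → ℝ, Continuous f → HasCompactSupport f →
        Tendsto (fun n => ∫ x, f x * g n x) 𝒰 (𝓝 (∫ x, f x ∂ν)) := by
  have hlim : ∀ f : C_c(EuclideanSpace ℝ (Fin N), ℝ), ∃ L,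
      Tendsto (fun n => ∫ x, f x * g n x) 𝒰 (𝓝 L) := by
    intro f
    obtain ⟨C, hC⟩ := hb f f.continuous f.hasCompactSupport
    obtain ⟨L, -, hL⟩ := (isCompact_Icc (a := -C) (b := C)).ultrafilter_le_nhds'
      (𝒰.map fun n => ∫ x, f x * g n x) (Ultrafilter.mem_map.2
        (Filter.univ_mem' fun n => abs_le.1 (hC n)))
    exact ⟨L, hL⟩
  choose L hL using hlim
  have hint : ∀ (f : C_c(EuclideanSpace ℝ (Fin N), ℝ)) n, Integrable (fun x => f x * g n x) volume :=
    fun f n => (hg n).integrable_smul_left_of_hasCompactSupport f.continuous f.hasCompactSupport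
  let Λ₀ : C_c(EuclideanSpace ℝ (Fin N), ℝ) →ₗ[ℝ] ℝ :=
    { toFun := L
      map_add' := fun f₁ f₂ => by
        refine tendsto_nhds_unique (hL (f₁ + f₂)) (((hL f₁).add (hL f₂)).congr fun n => ?_)
        rw [← integral_add (hint f₁ n) (hint f₂ n)]
        congr 1; ext x; simp [add_mul]
      map_smul' := fun c f => by
        refine tendsto_nhds_unique (hL (c • f)) (((hL f).const_mul c).congr fun n => ?_)
        rw [← integral_const_mul]
        congr 1; ext x; simp [mul_assoc] }
  let Λ : C_c(EuclideanSpace ℝ (Fin N), ℝ) →ₚ[ℝ] ℝ := PositiveLinearMap.mk₀ Λ₀ fun f hf =>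
    ge_of_tendsto (hL f) (Eventually.of_forall fun n =>
      integral_nonneg fun x => mul_nonneg (hf x) (hg0 n x))
  refine ⟨RealRMK.rieszMeasure Λ, inferInstance, fun f hf hs => ?_⟩
  have h := RealRMK.integral_rieszMeasure Λ ⟨⟨f, hf⟩, hs⟩
  have h2 := hL ⟨⟨f, hf⟩, hs⟩
  change ∫ x, f x ∂(RealRMK.rieszMeasure Λ) = L ⟨⟨f, hf⟩, hs⟩ at h
  rw [h]
  exact h2

theorem measure_open_le {ν : Measure (EuclideanSpace ℝ (Fin N))} [ν.Regular]
    {U : Set (EuclideanSpace ℝ (Fin N))} (hU : IsOpen U) {C : ℝ≥0∞}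
    (h : ∀ f : EuclideanSpace ℝ (Fin N) → ℝ, Continuous f → HasCompactSupport f → tsupport f ⊆ U →
      (∀ x, 0 ≤ f x ∧ f x ≤ 1) → ∫⁻ x, ENNReal.ofReal (f x) ∂ν ≤ C) : ν U ≤ C := by
  rw [hU.measure_eq_iSup_isCompact]
  refine iSup₂_le fun K hKU => iSup_le fun hK => ?_
  obtain ⟨f, hf1, hfs, hfU, hf01⟩ := exists_continuousMap_one_of_isCompact_subset_isOpen hK hU hKU
  calc ν K = ∫⁻ x, K.indicator 1 x ∂ν := by rw [lintegral_indicator_one hK.measurableSet]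
    _ ≤ ∫⁻ x, ENNReal.ofReal (f x) ∂ν := lintegral_mono fun x => by
        by_cases hx : x ∈ K
        · have := hf1 hx
          simp only [Pi.one_apply] at this
          simp [hx, this]
        · simp [hx]
    _ ≤ _ := h f f.continuous hfs hfU hf01

/-- Positive and negative parts inherit the `L^1` bound and each has a limit measure; testing with
functions between zero and one shows that these measures are finite, so their difference is a signed
measure. -/
theorem exists_signedMeasure_tendsto {g : ℕ → EuclideanSpace ℝ (Fin N) → ℝ}
    (hg : ∀ n, Integrable (g n) volume) {C : ℝ} (hC : ∀ n, ∫ x, |g n x| ≤ C) (𝒰 : Ultrafilter ℕ) :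
    ∃ μ : SignedMeasure (EuclideanSpace ℝ (Fin N)),
      ∀ f : EuclideanSpace ℝ (Fin N) → ℝ, Continuous f → HasCompactSupport f →
        Tendsto (fun n => ∫ x, f x * g n x) 𝒰 (𝓝 (∫ᵛ x, f x ∂<•μ)) := by
  have key : ∀ k : ℕ → EuclideanSpace ℝ (Fin N) → ℝ, (∀ n, Integrable (k n) volume) →
      (∀ n, ∫ x, |k n x| ≤ C) → (∀ n x, 0 ≤ k n x) →
      ∃ ν : Measure (EuclideanSpace ℝ (Fin N)), IsFiniteMeasure ν ∧
      ∀ f : EuclideanSpace ℝ (Fin N) → ℝ, Continuous f → HasCompactSupport f →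
        Tendsto (fun n => ∫ x, f x * k n x) 𝒰 (𝓝 (∫ x, f x ∂ν)) := by
    intro k hk hkC hk0
    have hbd : ∀ f : EuclideanSpace ℝ (Fin N) → ℝ, ∀ B, (∀ x, |f x| ≤ B) → ∀ n,
        |∫ x, f x * k n x| ≤ B * C := by
      intro f B hB n
      have hB0 : 0 ≤ B := (abs_nonneg _).trans (hB 0)
      rw [← Real.norm_eq_abs]
      refine (norm_integral_le_of_norm_le ((hk n).abs.const_mul B) (ae_of_all _ fun x => ?_)).trans ?_
      · rw [norm_mul]
        exact mul_le_mul_of_nonneg_right (hB x) (abs_nonneg _)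
      · rw [integral_const_mul]
        exact mul_le_mul_of_nonneg_left (hkC n) hB0
    obtain ⟨ν, hν, hνt⟩ := exists_measure_tendsto hk0 (fun n => (hk n).locallyIntegrable)
      (fun f hf hs => by
        obtain ⟨B, hB⟩ := exists_abs_le_of_hasCompactSupport hf hs
        exact ⟨_, hbd f B hB⟩) 𝒰
    refine ⟨ν, ⟨(measure_open_le (C := ENNReal.ofReal C) isOpen_univ
      fun f hf hs _ hf01 => ?_).trans_lt ENNReal.ofReal_lt_top⟩, hνt⟩
    rw [← ofReal_integral_eq_lintegral_ofReal (hf.integrable_of_hasCompactSupport hs)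
      (ae_of_all _ fun x => (hf01 x).1)]
    refine ENNReal.ofReal_le_ofReal ?_
    refine le_of_tendsto (hνt f hf hs) (Filter.univ_mem' fun n => ?_)
    have := hbd f 1 (fun x => abs_le.2 ⟨by linarith [(hf01 x).1], (hf01 x).2⟩) n
    rw [one_mul] at this
    exact (le_abs_self _).trans this
  have hle : ∀ n, ∫ x, |max (g n x) 0| ≤ C ∧ ∫ x, |max (-g n x) 0| ≤ C := fun n =>
    ⟨(integral_mono (hg n).pos_part.abs (hg n).abs fun x => by
        rcases le_total 0 (g n x) with h | h <;> simp [h]).trans (hC n),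
      (integral_mono (hg n).neg_part.abs (hg n).abs fun x => by
        rcases le_total 0 (g n x) with h | h <;> simp [h]).trans (hC n)⟩
  obtain ⟨ν₁, h₁, ht₁⟩ := key (fun n x => max (g n x) 0) (fun n => (hg n).pos_part)
    (fun n => (hle n).1) fun n x => le_max_right _ _
  obtain ⟨ν₂, h₂, ht₂⟩ := key (fun n x => max (-g n x) 0) (fun n => (hg n).neg_part)
    (fun n => (hle n).2) fun n x => le_max_right _ _
  refine ⟨ν₁.toSignedMeasure - ν₂.toSignedMeasure, fun f hf hs => ?_⟩
  obtain ⟨B, hB⟩ := exists_abs_le_of_hasCompactSupport hf hs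
  rw [VectorMeasure.integral_sub_vectorMeasure (vintegrable_of_hasCompactSupport _ hf hs)
    (vintegrable_of_hasCompactSupport _ hf hs), VectorMeasure.integral_toSignedMeasure,
    VectorMeasure.integral_toSignedMeasure]
  refine ((ht₁ f hf hs).sub (ht₂ f hf hs)).congr fun n => ?_
  rw [← integral_sub ((hg n).pos_part.bdd_mul hf.aestronglyMeasurable (ae_of_all _ hB))
    ((hg n).neg_part.bdd_mul hf.aestronglyMeasurable (ae_of_all _ hB))]
  congr 1; ext x
  rcases le_total 0 (g n x) with h | h <;> simp [h]

/-! ### Densities in `L^q` by duality -/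

/-- Continuous functions of compact support are dense in `L^r`; Fatou along an almost everywhere
convergent subsequence passes to the limit, with no integrability of `w` assumed. -/
theorem lintegral_mul_le_of_continuous {w : EuclideanSpace ℝ (Fin N) → ℝ≥0∞} (hw : Measurable w)
    {r : ℝ} (hr : 1 ≤ r) {C : ℝ≥0∞} (hC : C ≠ ⊤)
    (h : ∀ f : EuclideanSpace ℝ (Fin N) → ℝ, Continuous f → HasCompactSupport f → (∀ x, 0 ≤ f x) →
      ∫⁻ x, ENNReal.ofReal (f x) * w x ≤ C * eLpNorm f (ENNReal.ofReal r) volume)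
    {v : EuclideanSpace ℝ (Fin N) → ℝ} (hv0 : ∀ x, 0 ≤ v x)
    (hv : MemLp v (ENNReal.ofReal r) volume) :
    ∫⁻ x, ENNReal.ofReal (v x) * w x ≤ C * eLpNorm v (ENNReal.ofReal r) volume := by
  have hr0 : ENNReal.ofReal r ≠ 0 := by simp; linarith
  have hex : ∀ n : ℕ, ∃ f : EuclideanSpace ℝ (Fin N) → ℝ, Continuous f ∧ HasCompactSupport f ∧
      (∀ x, 0 ≤ f x) ∧ eLpNorm (f - v) (ENNReal.ofReal r) volume ≤ ((n : ℝ≥0∞) + 1)⁻¹ := by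
    intro n
    obtain ⟨f, hfs, hfv, hfc, -⟩ := hv.exists_hasCompactSupport_eLpNorm_sub_le
      ENNReal.ofReal_ne_top (ε := ((n : ℝ≥0∞) + 1)⁻¹) (by simp)
    -- Taking positive parts is a contraction and fixes `v`, so the approximants may be taken
    -- nonnegative.
    refine ⟨fun x => max (f x) 0, hfc.max continuous_const,
      hfs.comp_left (g := fun y => max y 0) (by simp), fun x => le_max_right _ _, ?_⟩
    rw [eLpNorm_sub_comm] at hfv
    refine (eLpNorm_mono fun x => ?_).trans hfv
    simp only [Pi.sub_apply, Real.norm_eq_abs]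
    have := abs_max_sub_max_le_abs (f x) (v x) 0
    rwa [max_eq_left (hv0 x)] at this
  choose f hfc hfs hf0 hfv using hex
  have hinv : Tendsto (fun n : ℕ => ((n : ℝ≥0∞) + 1)⁻¹) atTop (𝓝 0) := by
    have := (ENNReal.tendsto_inv_nat_nhds_zero).comp (tendsto_add_atTop_nat 1)
    refine this.congr fun n => ?_
    simp
  have hconv : Tendsto (fun n => eLpNorm (f n - v) (ENNReal.ofReal r) volume) atTop (𝓝 0) :=
    tendsto_of_tendsto_of_tendsto_of_le_of_le tendsto_const_nhds hinv (fun _ => zero_le) hfv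
  obtain ⟨ns, hns, hae⟩ := (tendstoInMeasure_of_tendsto_eLpNorm hr0
    (fun n => (hfc n).aestronglyMeasurable) hv.1 hconv).exists_seq_tendsto_ae
  have hbound : ∀ n, eLpNorm (f n) (ENNReal.ofReal r) volume ≤
      eLpNorm (f n - v) (ENNReal.ofReal r) volume + eLpNorm v (ENNReal.ofReal r) volume := by
    intro n
    have := eLpNorm_add_le ((hfc n).aestronglyMeasurable.sub hv.1) hv.1
      (p := ENNReal.ofReal r) (by simpa using hr)
    rwa [sub_add_cancel] at this
  calc ∫⁻ x, ENNReal.ofReal (v x) * w x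
      ≤ ∫⁻ x, liminf (fun n => ENNReal.ofReal (f (ns n) x) * w x) atTop := by
        refine lintegral_mono_ae (hae.mono fun x hx => ?_)
        -- Where `v` vanishes, `w` may be infinite and the product need not be continuous; there the
        -- left side is zero anyway.
        rcases eq_or_ne (ENNReal.ofReal (v x)) 0 with h0 | h0
        · simp [h0]
        · exact (ENNReal.Tendsto.mul_const (ENNReal.tendsto_ofReal hx) (Or.inl h0)).liminf_eq.ge
    _ ≤ liminf (fun n => ∫⁻ x, ENNReal.ofReal (f (ns n) x) * w x) atTop :=
        lintegral_liminf_le fun n => (hfc _).measurable.ennreal_ofReal.mul hw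
    _ ≤ liminf (fun n => C * (eLpNorm (f (ns n) - v) (ENNReal.ofReal r) volume +
          eLpNorm v (ENNReal.ofReal r) volume)) atTop :=
        liminf_le_liminf (Eventually.of_forall fun n =>
          (h _ (hfc _) (hfs _) (hf0 _)).trans (by gcongr; exact hbound _))
    _ = C * eLpNorm v (ENNReal.ofReal r) volume := by
        refine Tendsto.liminf_eq ?_
        have h1 := (hconv.comp hns.tendsto_atTop).add_const (eLpNorm v (ENNReal.ofReal r) volume)
        rw [zero_add] at h1
        exact ENNReal.Tendsto.const_mul h1 (Or.inr hC)

/-- Test functions below the indicator of an open `U` give `ν U ≤ C * volume U ^ (1 / r)`; null sets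
are covered by open sets of small volume. -/
theorem absolutelyContinuous_of_lintegral_le {ν : Measure (EuclideanSpace ℝ (Fin N))} [ν.Regular]
    {r : ℝ} (hr : 1 ≤ r) {C : ℝ≥0∞} (hC : C ≠ ⊤)
    (h : ∀ f : EuclideanSpace ℝ (Fin N) → ℝ, Continuous f → HasCompactSupport f → (∀ x, 0 ≤ f x) →
      ∫⁻ x, ENNReal.ofReal (f x) ∂ν ≤ C * eLpNorm f (ENNReal.ofReal r) volume) :
    ν ≪ volume := by
  have hr0 : 0 < r := by linarith
  have hopen : ∀ U : Set (EuclideanSpace ℝ (Fin N)), IsOpen U →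
      ν U ≤ C * volume U ^ (1 / r) := fun U hU => measure_open_le hU fun f hf hs hfU hf01 => by
    refine (h f hf hs fun x => (hf01 x).1).trans ?_
    gcongr
    have h1 : eLpNorm f (ENNReal.ofReal r) volume ≤
        eLpNorm (U.indicator fun _ => (1 : ℝ)) (ENNReal.ofReal r) volume := eLpNorm_mono fun x => by
      by_cases hx : x ∈ U
      · simpa [hx, abs_of_nonneg (hf01 x).1] using (hf01 x).2
      · simp [hx, image_eq_zero_of_notMem_tsupport fun hx' => hx (hfU hx')]
    rw [eLpNorm_indicator_const hU.measurableSet (by simpa using hr0) ENNReal.ofReal_ne_top] at h1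
    simpa [ENNReal.toReal_ofReal hr0.le] using h1
  intro A hA
  have hlim : Tendsto (fun n : ℕ => C * ((n : ℝ≥0∞)⁻¹) ^ (1 / r)) atTop (𝓝 0) := by
    have h1 := ((ENNReal.continuous_rpow_const (y := 1 / r)).tendsto 0).comp
      ENNReal.tendsto_inv_nat_nhds_zero
    rw [ENNReal.zero_rpow_of_pos (by positivity)] at h1
    simpa using ENNReal.Tendsto.const_mul h1 (Or.inr hC)
  refine le_antisymm (ge_of_tendsto' hlim fun n => ?_) zero_le
  obtain ⟨U, hAU, hU, hUn⟩ := A.exists_isOpen_lt_of_lt (μ := volume) ((n : ℝ≥0∞)⁻¹) (by simp [hA])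
  exact (measure_mono hAU).trans ((hopen U hU).trans (by gcongr))

/-- The converse of Hölder, obtained by testing with the `(q - 1)`-th power of `w` itself: `J ≤ C *
J ^ (1 - 1 / q)` for the integral `J` of the `q`-th power. -/
theorem lintegral_rpow_le_of_lintegral_mul_le {w : EuclideanSpace ℝ (Fin N) → ℝ≥0∞}
    (hw : Measurable w) {q : ℝ} (hq : 1 < q) {C : ℝ≥0∞} (hC : C ≠ ⊤)
    (h : ∀ f : EuclideanSpace ℝ (Fin N) → ℝ, Continuous f → HasCompactSupport f → (∀ x, 0 ≤ f x) →
      ∫⁻ x, ENNReal.ofReal (f x) * w x ≤ C * eLpNorm f (ENNReal.ofReal (q / (q - 1))) volume) :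
    ∫⁻ x, w x ^ q ≤ C ^ q := by
  have hq1 : 0 < q - 1 := by linarith
  have hq0 : 0 < q := by linarith
  have hr : 1 ≤ q / (q - 1) := by rw [le_div_iff₀ hq1]; linarith
  have hr0 : 0 < q / (q - 1) := by positivity
  -- Truncation in height and in space makes the integral finite, so that it may be divided out;
  -- Fatou removes the truncation.
  let m : ℕ → EuclideanSpace ℝ (Fin N) → ℝ≥0∞ := fun k =>
    (Metric.ball 0 k).indicator fun x => min (w x) k
  have hm : ∀ k, Measurable (m k) := fun k =>
    (hw.min measurable_const).indicator measurableSet_ball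
  have hmk : ∀ k x, m k x ≤ k := fun k x => Set.indicator_le (fun _ _ => min_le_right _ _) x
  have hmw : ∀ k x, m k x ≤ w x := fun k x => Set.indicator_le (fun _ _ => min_le_left _ _) x
  have hmt : ∀ k x, m k x ≠ ⊤ := fun k x => ((hmk k x).trans_lt (ENNReal.natCast_lt_top k)).ne
  have hJ : ∀ k, ∫⁻ x, m k x ^ q ≤ C ^ q := by
    intro k
    have hfin : ∫⁻ x, m k x ^ q ≠ ⊤ := by
      refine ((lintegral_mono (g := (Metric.ball 0 (k : ℝ)).indicator fun _ => (k : ℝ≥0∞) ^ q)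
        fun x => ?_).trans_lt ?_).ne
      · by_cases hx : x ∈ Metric.ball (0 : EuclideanSpace ℝ (Fin N)) k
        · simp only [hx, Set.indicator_of_mem]
          exact ENNReal.rpow_le_rpow (hmk k x) hq0.le
        · simp only [m, Set.indicator_of_notMem hx]
          simp [hq0]
      · rw [lintegral_indicator_const measurableSet_ball]
        exact ENNReal.mul_lt_top (ENNReal.rpow_lt_top_of_nonneg hq0.le (ENNReal.natCast_ne_top k))
          measure_ball_lt_top
    have hvr : ∀ x, ENNReal.ofReal ((m k x).toReal ^ (q - 1)) = m k x ^ (q - 1) := fun x => by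
      rw [← ENNReal.ofReal_rpow_of_nonneg ENNReal.toReal_nonneg hq1.le,
        ENNReal.ofReal_toReal (hmt k x)]
    have hv0 : ∀ x, 0 ≤ (m k x).toReal ^ (q - 1) := fun x => by positivity
    have hnorm : eLpNorm (fun x => (m k x).toReal ^ (q - 1)) (ENNReal.ofReal (q / (q - 1))) volume
        = (∫⁻ x, m k x ^ q) ^ (1 - 1 / q) := by
      rw [eLpNorm_eq_lintegral_rpow_enorm_toReal (by simpa using hr0) ENNReal.ofReal_ne_top,
        ENNReal.toReal_ofReal hr0.le]
      congr 1
      · refine lintegral_congr fun x => ?_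
        rw [Real.enorm_of_nonneg (hv0 x), hvr, ← ENNReal.rpow_mul]
        congr 1; field_simp
      · field_simp
    have hmem : MemLp (fun x => (m k x).toReal ^ (q - 1)) (ENNReal.ofReal (q / (q - 1))) volume :=
      ⟨((hm k).ennreal_toReal.pow_const _).aestronglyMeasurable, by
        rw [hnorm]
        refine ENNReal.rpow_lt_top_of_nonneg ?_ hfin
        rw [sub_nonneg, div_le_one hq0]; exact hq.le⟩
    have h1 := lintegral_mul_le_of_continuous hw hr hC h hv0 hmem
    rw [hnorm] at h1
    have h2 : ∫⁻ x, m k x ^ q ≤ C * (∫⁻ x, m k x ^ q) ^ (1 - 1 / q) := by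
      refine (lintegral_mono fun x => ?_).trans h1
      rw [hvr]
      calc m k x ^ q = m k x ^ (q - 1) * m k x := by
            conv_rhs => rw [← ENNReal.rpow_one (m k x), ← ENNReal.rpow_mul,
              ← ENNReal.rpow_add_of_nonneg _ _ (by simpa using hq1.le) zero_le_one]
            simp
        _ ≤ _ := by gcongr; exact hmw k x
    rcases eq_or_ne (∫⁻ x, m k x ^ q) 0 with h0 | h0
    · simp [h0]
    set J := ∫⁻ x, m k x ^ q
    have h3 : J ^ (1 / q) ≤ C := by
      have hne : J ^ (1 - 1 / q) ≠ 0 := (ENNReal.rpow_pos (pos_iff_ne_zero.2 h0) hfin).ne'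
      have hnt : J ^ (1 - 1 / q) ≠ ⊤ := ENNReal.rpow_ne_top_of_ne_zero h0 hfin
      refine (ENNReal.mul_le_mul_iff_left hne hnt).1 (le_trans (le_of_eq ?_) h2)
      rw [← ENNReal.rpow_add _ _ h0 hfin]
      simp
    calc J = (J ^ (1 / q)) ^ q := by rw [← ENNReal.rpow_mul]; simp [hq0.ne']
      _ ≤ _ := by gcongr
  have hlim : ∀ x, Tendsto (fun k => m k x ^ q) atTop (𝓝 (w x ^ q)) := by
    intro x
    refine ((ENNReal.continuous_rpow_const (y := q)).tendsto _).comp ?_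
    have h1 : Tendsto (fun k : ℕ => min (w x) (k : ℝ≥0∞)) atTop (𝓝 (w x)) := by
      simpa using (tendsto_const_nhds (x := w x)).min ENNReal.tendsto_nat_nhds_top
    refine h1.congr' ?_
    filter_upwards [tendsto_natCast_atTop_atTop.eventually (eventually_gt_atTop ‖x‖)] with k hk
    simp [m, hk]
  calc ∫⁻ x, w x ^ q = ∫⁻ x, liminf (fun k => m k x ^ q) atTop :=
        lintegral_congr fun x => (hlim x).liminf_eq.symm
    _ ≤ liminf (fun k => ∫⁻ x, m k x ^ q) atTop :=
        lintegral_liminf_le fun k => (hm k).pow_const q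
    _ ≤ C ^ q := liminf_le_of_le (by isBoundedDefault) fun b hb => by
        obtain ⟨k, hk⟩ := hb.exists
        exact hk.trans (hJ k)

/-- The Radon–Nikodym derivative exists by absolute continuity and lies in `L^q` by the converse of
Hölder. -/
theorem exists_memLp_density {ν : Measure (EuclideanSpace ℝ (Fin N))} [ν.Regular]
    {q : ℝ} (hq : 1 < q) {C : ℝ≥0∞} (hC : C ≠ ⊤)
    (h : ∀ f : EuclideanSpace ℝ (Fin N) → ℝ, Continuous f → HasCompactSupport f → (∀ x, 0 ≤ f x) →
      ∫⁻ x, ENNReal.ofReal (f x) ∂ν ≤ C * eLpNorm f (ENNReal.ofReal (q / (q - 1))) volume) :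
    ∃ k : EuclideanSpace ℝ (Fin N) → ℝ, MemLp k (ENNReal.ofReal q) volume ∧
      ∀ f : EuclideanSpace ℝ (Fin N) → ℝ, ∫ x, f x ∂ν = ∫ x, f x * k x := by
  have hq0 : 0 < q := by linarith
  have hr : 1 ≤ q / (q - 1) := by rw [le_div_iff₀ (by linarith)]; linarith
  have hac := absolutelyContinuous_of_lintegral_le hr hC h
  have hw : Measurable (ν.rnDeriv volume) := Measure.measurable_rnDeriv _ _
  have hν : volume.withDensity (ν.rnDeriv volume) = ν := Measure.withDensity_rnDeriv_eq _ _ hac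
  have hlt : ∀ᵐ x, ν.rnDeriv volume x < ⊤ := Measure.rnDeriv_lt_top ν volume
  refine ⟨fun x => (ν.rnDeriv volume x).toReal, ⟨hw.ennreal_toReal.aestronglyMeasurable, ?_⟩,
    fun f => ?_⟩
  · have hint := lintegral_rpow_le_of_lintegral_mul_le hw hq hC fun f hf hs hf0 => by
      refine le_trans (le_of_eq ?_) (h f hf hs hf0)
      conv_rhs => rw [← hν]
      rw [lintegral_withDensity_eq_lintegral_mul _ hw hf.measurable.ennreal_ofReal]
      simp [mul_comm]
    rw [eLpNorm_eq_lintegral_rpow_enorm_toReal (by simpa using hq0) ENNReal.ofReal_ne_top,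
      ENNReal.toReal_ofReal hq0.le]
    refine ENNReal.rpow_lt_top_of_nonneg (by positivity) (ne_top_of_le_ne_top
      (ENNReal.rpow_ne_top_of_nonneg hq0.le hC) (le_trans (le_of_eq ?_) hint))
    refine lintegral_congr_ae (hlt.mono fun x hx => ?_)
    simp [Real.enorm_of_nonneg, ENNReal.ofReal_toReal hx.ne]
  · conv_lhs => rw [← hν]
    rw [integral_withDensity_eq_integral_toReal_smul₀ hw.aemeasurable hlt]
    simp [mul_comm]

theorem lintegral_enorm_mul_le {q : ℝ} (hq : 1 < q) {f g : EuclideanSpace ℝ (Fin N) → ℝ}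
    (hf : AEStronglyMeasurable f volume) (hg : AEStronglyMeasurable g volume) :
    ∫⁻ x, ‖f x * g x‖ₑ ≤ eLpNorm f (ENNReal.ofReal (q / (q - 1))) volume *
      eLpNorm g (ENNReal.ofReal q) volume := by
  have hq1 : 0 < q - 1 := by linarith
  have hq0 : 0 < q := by linarith
  have h := eLpNorm_mul_le_of_holder (a := (q - 1) / q) (q := q) (r := 1) (by positivity) hq0
    (by field_simp; ring) hf hg
  rwa [ENNReal.ofReal_one, eLpNorm_one_eq_lintegral_enorm, inv_div] at h

theorem exists_memLp_tendsto {q : ℝ} (hq : 1 < q) {g : ℕ → EuclideanSpace ℝ (Fin N) → ℝ}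
    (hg : ∀ n, MemLp (g n) (ENNReal.ofReal q) volume) {C : ℝ≥0∞} (hC : C ≠ ⊤)
    (hgC : ∀ n, eLpNorm (g n) (ENNReal.ofReal q) volume ≤ C) (𝒰 : Ultrafilter ℕ) :
    ∃ k : EuclideanSpace ℝ (Fin N) → ℝ, MemLp k (ENNReal.ofReal q) volume ∧
      ∀ f : EuclideanSpace ℝ (Fin N) → ℝ, Continuous f → HasCompactSupport f →
        Tendsto (fun n => ∫ x, f x * g n x) 𝒰 (𝓝 (∫ x, f x * k x)) := by
  have hq' : 1 ≤ ENNReal.ofReal q := by simpa using hq.le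
  have key : ∀ g : ℕ → EuclideanSpace ℝ (Fin N) → ℝ,
      (∀ n, MemLp (g n) (ENNReal.ofReal q) volume) →
      (∀ n, eLpNorm (g n) (ENNReal.ofReal q) volume ≤ C) → (∀ n x, 0 ≤ g n x) →
      ∃ k : EuclideanSpace ℝ (Fin N) → ℝ, MemLp k (ENNReal.ofReal q) volume ∧
      ∀ f : EuclideanSpace ℝ (Fin N) → ℝ, Continuous f → HasCompactSupport f →
        Tendsto (fun n => ∫ x, f x * g n x) 𝒰 (𝓝 (∫ x, f x * k x)) := by
    intro g hg hgC hg0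
    have hbd : ∀ f : EuclideanSpace ℝ (Fin N) → ℝ, Continuous f → ∀ n,
        ‖∫ x, f x * g n x‖ₑ ≤ C * eLpNorm f (ENNReal.ofReal (q / (q - 1))) volume := by
      intro f hf n
      refine (enorm_integral_le_lintegral_enorm _).trans
        ((lintegral_enorm_mul_le hq hf.aestronglyMeasurable (hg n).1).trans ?_)
      rw [mul_comm]
      gcongr
      exact hgC n
    obtain ⟨ν, hν, hνt⟩ := exists_measure_tendsto hg0 (fun n => (hg n).locallyIntegrable hq')
      (fun f hf hs => by
        refine ⟨(C * eLpNorm f (ENNReal.ofReal (q / (q - 1))) volume).toReal, fun n => ?_⟩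
        rw [← Real.norm_eq_abs, ← toReal_enorm]
        exact ENNReal.toReal_mono (ENNReal.mul_ne_top hC
          (hf.memLp_of_hasCompactSupport hs).eLpNorm_ne_top) (hbd f hf n)) 𝒰
    obtain ⟨k, hk, hkf⟩ := exists_memLp_density (ν := ν) hq hC fun f hf hs hf0 => by
      rw [← ofReal_integral_eq_lintegral_ofReal (hf.integrable_of_hasCompactSupport hs)
        (ae_of_all _ hf0)]
      refine le_of_tendsto (ENNReal.tendsto_ofReal (hνt f hf hs)) (Eventually.of_forall fun n => ?_)
      exact (Real.ofReal_le_enorm _).trans (hbd f hf n)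
    exact ⟨k, hk, fun f hf hs => hkf f ▸ hνt f hf hs⟩
  have hpos : ∀ n, MemLp (fun x => max (g n x) 0) (ENNReal.ofReal q) volume := fun n => (hg n).pos_part
  have hneg : ∀ n, MemLp (fun x => max (-g n x) 0) (ENNReal.ofReal q) volume := fun n =>
    (hg n).neg_part
  obtain ⟨k₁, h₁, ht₁⟩ := key (fun n x => max (g n x) 0) hpos
    (fun n => (eLpNorm_mono fun x => by
      rcases le_total 0 (g n x) with h | h <;> simp [h]).trans (hgC n)) fun n x => le_max_right _ _
  obtain ⟨k₂, h₂, ht₂⟩ := key (fun n x => max (-g n x) 0) hneg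
    (fun n => (eLpNorm_mono fun x => by
      rcases le_total 0 (g n x) with h | h <;> simp [h]).trans (hgC n)) fun n x => le_max_right _ _
  refine ⟨k₁ - k₂, h₁.sub h₂, fun f hf hs => ?_⟩
  have hint : ∀ {k : EuclideanSpace ℝ (Fin N) → ℝ}, MemLp k (ENNReal.ofReal q) volume →
      Integrable (fun x => f x * k x) volume := fun hk =>
    (hk.locallyIntegrable hq').integrable_smul_left_of_hasCompactSupport hf hs
  have h3 : ∫ x, f x * (k₁ - k₂) x = (∫ x, f x * k₁ x) - ∫ x, f x * k₂ x := by
    rw [← integral_sub (hint h₁) (hint h₂)]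
    congr 1; ext x; simp [mul_sub]
  rw [h3]
  refine ((ht₁ f hf hs).sub (ht₂ f hf hs)).congr fun n => ?_
  rw [← integral_sub (hint (hpos n)) (hint (hneg n))]
  congr 1; ext x
  rcases le_total 0 (g n x) with h | h <;> simp [h]

/-! ### Limits of bounded sequences of test functions -/

theorem eLpNorm_pderiv_le_testNorm {N₁ : ℕ} {p : Fin N → ℝ}
    (hp_one : ∀ i : Fin N, (i : ℕ) < N₁ → p i = 1) (φ : EuclideanSpace ℝ (Fin N) → ℝ) (i : Fin N) :
    eLpNorm (pderiv i φ) (ENNReal.ofReal (p i)) volume ≤ testNorm N₁ p φ := by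
  rcases lt_or_ge (i : ℕ) N₁ with hi | hi
  · rw [hp_one i hi, ENNReal.ofReal_one]
    refine (eLpNorm_mono fun x => ?_).trans le_self_add
    rw [Real.norm_eq_abs, Real.norm_eq_abs, abs_of_nonneg (Real.sqrt_nonneg _)]
    refine Real.abs_le_sqrt (Finset.single_le_sum (f := fun i => pderiv i φ x ^ 2)
      (fun j _ => sq_nonneg _) (by simpa [firstIdx] using hi))
  · exact le_trans (Finset.single_le_sum
      (f := fun i => eLpNorm (pderiv i φ) (ENNReal.ofReal (p i)) volume)
      (fun j _ => zero_le) (by simpa [lastIdx] using hi)) le_add_self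

/-- Troisi turns the derivative bound into an `L^q` bound, and weak limits along an ultrafilter
exist for the sequence and for each derivative. Convergence in distributions forces them to be `u`
and its derivatives; no limit needs to be independent of the ultrafilter beforehand. -/
theorem mem_BV_of_testNorm_le {N₁ : ℕ} {p : Fin N → ℝ} (hq : 1 < critExp p)
    (hp_one : ∀ i : Fin N, (i : ℕ) < N₁ → p i = 1)
    (hp_gt : ∀ i : Fin N, N₁ ≤ (i : ℕ) → 1 < p i) {T₀ : ℝ} (hT₀ : 0 < T₀)
    (hT : ∀ φ : EuclideanSpace ℝ (Fin N) → ℝ, IsTest φ →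
        ENNReal.ofReal T₀ * eLpNorm φ (ENNReal.ofReal (critExp p)) volume
          ≤ ∏ i, eLpNorm (pderiv i φ) (ENNReal.ofReal (p i)) volume ^ (1 / (N : ℝ)))
    {us : ℕ → EuclideanSpace ℝ (Fin N) → ℝ} (hus : ∀ n, IsTest (us n)) {C : ℝ}
    (hC : ∀ n, testNorm N₁ p (us n) ≤ ENNReal.ofReal C) {u : EuclideanSpace ℝ (Fin N) → ℝ}
    (hu : ConvergesInDistributions us u) : u ∈ BV N₁ p := by
  have hder : ∀ n i, eLpNorm (pderiv i (us n)) (ENNReal.ofReal (p i)) volume ≤ ENNReal.ofReal C :=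
    fun n i => (eLpNorm_pderiv_le_testNorm hp_one _ i).trans (hC n)
  set B : ℝ≥0∞ := ∏ _i : Fin N, ENNReal.ofReal C ^ (1 / (N : ℝ)) with hB
  have hBtop : B ≠ ⊤ := ENNReal.prod_ne_top fun i _ =>
    ENNReal.rpow_ne_top_of_nonneg (by positivity) ENNReal.ofReal_ne_top
  have hT0 : ENNReal.ofReal T₀ ≠ 0 := by simpa using hT₀
  have hbd : ∀ n, eLpNorm (us n) (ENNReal.ofReal (critExp p)) volume ≤ B / ENNReal.ofReal T₀ := by
    intro n
    rw [ENNReal.le_div_iff_mul_le (Or.inl hT0) (Or.inl ENNReal.ofReal_ne_top), mul_comm]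
    exact (hT _ (hus n)).trans (Finset.prod_le_prod' fun i _ =>
      ENNReal.rpow_le_rpow (hder n i) (by positivity))
  let 𝒰 : Ultrafilter ℕ := hyperfilter ℕ
  have h𝒰 : (𝒰 : Filter ℕ) ≤ atTop := Nat.hyperfilter_le_atTop
  obtain ⟨k, hk, hkt⟩ := exists_memLp_tendsto hq (fun n => (hus n).memLp _)
    (ENNReal.div_ne_top hBtop hT0) hbd 𝒰
  have huk : u =ᵐ[volume] k := by
    refine ae_eq_of_integral_contDiff_smul_eq hu.1 (hk.locallyIntegrable (by simpa using hq.le))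
      fun φ hφ hs => ?_
    have h1 := (hu.2 φ ⟨hφ, hs⟩).mono_left h𝒰
    simp_rw [mul_comm _ (φ _)] at h1
    exact tendsto_nhds_unique h1 (hkt φ hφ.continuous hs)
  -- Integration by parts puts the derivative on `φ`, where convergence in distributions applies to
  -- the test function `∂_i φ`.
  have hlim : ∀ i, ∀ φ : EuclideanSpace ℝ (Fin N) → ℝ, IsTest φ →
      Tendsto (fun n => ∫ x, φ x * pderiv i (us n) x) 𝒰 (𝓝 (- ∫ x, u x * pderiv i φ x)) := by
    intro i φ hφ
    refine (((hu.2 _ (hφ.contDiff_pderiv i)).mono_left h𝒰).neg).congr fun n => ?_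
    rw [(hus n).hasWeakDeriv i φ hφ, neg_neg]
    simp [mul_comm]
  refine ⟨hk.ae_eq huk.symm, fun i hi => ?_, fun i hi => ?_⟩
  · have hi' : (i : ℕ) < N₁ := by simpa [firstIdx] using hi
    have hint : ∀ n, ∫ x, |pderiv i (us n) x| ≤ (ENNReal.ofReal C).toReal := fun n => by
      have h1 := hder n i
      rw [hp_one i hi', ENNReal.ofReal_one, eLpNorm_one_eq_lintegral_enorm] at h1
      exact le_trans (integral_norm_eq_lintegral_enorm
        ((hus n).contDiff_pderiv i).continuous.aestronglyMeasurable).le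
        (ENNReal.toReal_mono ENNReal.ofReal_ne_top h1)
    obtain ⟨μ, hμ⟩ := exists_signedMeasure_tendsto
      (fun n => ((hus n).contDiff_pderiv i).integrable) hint 𝒰
    refine ⟨μ, fun φ hφ => ?_⟩
    rw [← tendsto_nhds_unique (hlim i φ hφ) (hμ φ hφ.continuous hφ.2), neg_neg]
  · have hi' : N₁ ≤ (i : ℕ) := by simpa [lastIdx] using hi
    obtain ⟨g, hg, hgt⟩ := exists_memLp_tendsto (hp_gt i hi')
      (fun n => ((hus n).contDiff_pderiv i).memLp _) ENNReal.ofReal_ne_top (fun n => hder n i) 𝒰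
    refine ⟨g, hg, fun φ hφ => ?_⟩
    have h2 := tendsto_nhds_unique (hlim i φ hφ) (hgt φ hφ.continuous hφ.2)
    simp_rw [mul_comm (g _)]
    rw [← h2, neg_neg]

/-! ### Strong convergence -/

theorem weakLp_of_tendsto_eLpNorm {q : ℝ} (hq : 1 < q) {f : ℕ → EuclideanSpace ℝ (Fin N) → ℝ}
    {g : EuclideanSpace ℝ (Fin N) → ℝ} (hf : ∀ n, MemLp (f n) (ENNReal.ofReal q) volume)
    (hg : MemLp g (ENNReal.ofReal q) volume)
    (h : Tendsto (fun n => eLpNorm (f n - g) (ENNReal.ofReal q) volume) atTop (𝓝 0)) :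
    WeakLp q f g := by
  intro v hv
  have hint : ∀ {k : EuclideanSpace ℝ (Fin N) → ℝ}, MemLp k (ENNReal.ofReal q) volume →
      Integrable (fun x => k x * v x) volume := fun {k} hk => by
    refine ⟨hk.1.mul hv.1, ?_⟩
    simp_rw [mul_comm (k _)]
    exact (lintegral_enorm_mul_le hq hv.1 hk.1).trans_lt (ENNReal.mul_lt_top hv.2 hk.2)
  have h1 : Tendsto (fun n => eLpNorm v (ENNReal.ofReal (q / (q - 1))) volume *
      eLpNorm (f n - g) (ENNReal.ofReal q) volume) atTop (𝓝 0) := by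
    simpa using ENNReal.Tendsto.const_mul h (Or.inr hv.eLpNorm_ne_top)
  rw [tendsto_iff_edist_tendsto_0]
  refine tendsto_of_tendsto_of_tendsto_of_le_of_le tendsto_const_nhds h1 (fun _ => zero_le)
    fun n => ?_
  rw [edist_eq_enorm_sub, ← integral_sub (hint (hf n)) (hint hg)]
  refine (enorm_integral_le_lintegral_enorm _).trans
    (le_trans (le_of_eq ?_) (lintegral_enorm_mul_le hq hv.1 ((hf n).sub hg).1))
  refine lintegral_congr fun x => ?_
  rw [Pi.sub_apply, ← sub_mul, mul_comm]

theorem tendsto_eLpNorm_of_tendsto_sub {q : ℝ≥0∞} (hq : 1 ≤ q)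
    {f : ℕ → EuclideanSpace ℝ (Fin N) → ℝ} {g : EuclideanSpace ℝ (Fin N) → ℝ}
    (hf : ∀ n, MemLp (f n) q volume) (hg : MemLp g q volume)
    (h : Tendsto (fun n => eLpNorm (f n - g) q volume) atTop (𝓝 0)) :
    Tendsto (fun n => eLpNorm (f n) q volume) atTop (𝓝 (eLpNorm g q volume)) := by
  have h1 : Tendsto (fun n => eLpNorm g q volume - eLpNorm (f n - g) q volume) atTop
      (𝓝 (eLpNorm g q volume)) := by
    simpa using ENNReal.Tendsto.sub (tendsto_const_nhds (x := eLpNorm g q volume)) h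
      (Or.inl hg.eLpNorm_ne_top)
  have h2 : Tendsto (fun n => eLpNorm (f n - g) q volume + eLpNorm g q volume) atTop
      (𝓝 (eLpNorm g q volume)) := by
    simpa using h.add_const (eLpNorm g q volume)
  refine tendsto_of_tendsto_of_tendsto_of_le_of_le h1 h2 (fun n => ?_) fun n => ?_
  · rw [tsub_le_iff_left, eLpNorm_sub_comm]
    simpa using eLpNorm_add_le (hg.sub (hf n)).1 (hf n).1 hq
  · simpa using eLpNorm_add_le ((hf n).sub hg).1 hg.1 hq

theorem integral_abs_rpow_eq {q : ℝ} (hq : 0 < q) {f : EuclideanSpace ℝ (Fin N) → ℝ}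
    (hf : MemLp f (ENNReal.ofReal q) volume) :
    ∫ x, |f x| ^ q = (eLpNorm f (ENNReal.ofReal q) volume).toReal ^ q := by
  have h0 : 0 ≤ ∫ x, |f x| ^ q := integral_nonneg fun x => by positivity
  rw [hf.eLpNorm_eq_integral_rpow_norm (by simpa using hq) ENNReal.ofReal_ne_top,
    ENNReal.toReal_ofReal hq.le]
  simp only [Real.norm_eq_abs]
  rw [ENNReal.toReal_ofReal (by positivity), ← Real.rpow_mul h0, inv_mul_cancel₀ hq.ne',
    Real.rpow_one]

theorem exists_ofReal_bound {a : ℕ → ℝ≥0∞} (ha : ∀ n, a n ≠ ⊤) {K : ℝ≥0∞} (hK : K ≠ ⊤)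
    (h : ∀ᶠ n in atTop, a n ≤ K) : ∃ C : ℝ, ∀ n, a n ≤ ENNReal.ofReal C := by
  obtain ⟨n₀, hn₀⟩ := eventually_atTop.1 h
  refine ⟨(K + ∑ n ∈ Finset.range n₀, a n).toReal, fun n => ?_⟩
  rw [ENNReal.ofReal_toReal (ENNReal.add_ne_top.2 ⟨hK, ENNReal.sum_ne_top.2 fun n _ => ha n⟩)]
  rcases lt_or_ge n n₀ with hn | hn
  · exact (Finset.single_le_sum (f := a) (fun _ _ => zero_le) (Finset.mem_range.2 hn)).trans
      le_add_self
  · exact (hn₀ n hn).trans le_self_add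

/-! ### Consequences of the approximation -/

theorem derivNorm_ne_top {N₁ : ℕ} {p : Fin N → ℝ} {u : EuclideanSpace ℝ (Fin N) → ℝ} {D : Grad N}
    (hD : IsBVGrad N₁ p u D) (i : Fin N) : derivNorm N₁ p D i ≠ ⊤ := by
  rw [derivNorm]
  split_ifs with hi
  · exact (totalMass_lt_top _ _).ne
  · exact (hD.func_memLp i (by simpa [lastIdx] using hi)).eLpNorm_ne_top

/-- The error is deliberately the same for all `i`, so that a single null sequence enters the
product in Troisi's inequality. -/
theorem eLpNorm_pderiv_le_derivNorm_add {N₁ : ℕ} {p : Fin N → ℝ} (hp : ∀ i, 1 ≤ p i)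
    (hp_one : ∀ i : Fin N, (i : ℕ) < N₁ → p i = 1)
    {u : EuclideanSpace ℝ (Fin N) → ℝ} {D : Grad N} (hD : IsBVGrad N₁ p u D)
    {φ : EuclideanSpace ℝ (Fin N) → ℝ} (hφ : IsTest φ) {ε : ℝ≥0∞}
    (hε : ∀ S ⊆ firstIdx N N₁, totalMass S (testGrad φ).meas ≤ totalMass S D.meas + ε) (i : Fin N) :
    eLpNorm (pderiv i φ) (ENNReal.ofReal (p i)) volume ≤ derivNorm N₁ p D i + (ε +
      ∑ j ∈ lastIdx N N₁, eLpNorm (pderiv j φ - D.func j) (ENNReal.ofReal (p j)) volume) := by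
  rw [derivNorm]
  split_ifs with hi
  · rw [hp_one i hi, ENNReal.ofReal_one, ← add_assoc]
    exact (hφ.eLpNorm_pderiv_le_totalMass i).trans
      ((hε {i} (by simpa [firstIdx] using hi)).trans le_self_add)
  · have hi' : i ∈ lastIdx N N₁ := by simpa [lastIdx] using hi
    have h1 := eLpNorm_add_le (p := ENNReal.ofReal (p i)) (hD.func_memLp i hi').1
      (((hφ.contDiff_pderiv i).memLp _).sub (hD.func_memLp i hi')).1 (by simpa using hp i)
    rw [add_sub_cancel] at h1
    refine h1.trans (add_le_add_right ((Finset.single_le_sum (f := fun j =>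
      eLpNorm (pderiv j φ - D.func j) (ENNReal.ofReal (p j)) volume) (fun _ _ => zero_le) hi').trans
      le_add_self) _)

theorem testNorm_le_sum {N₁ : ℕ} {p : Fin N → ℝ}
    (hp_one : ∀ i : Fin N, (i : ℕ) < N₁ → p i = 1)
    {φ : EuclideanSpace ℝ (Fin N) → ℝ} (hφ : IsTest φ) :
    testNorm N₁ p φ ≤ ∑ i, eLpNorm (pderiv i φ) (ENNReal.ofReal (p i)) volume := by
  have h1 : eLpNorm (fun x => √(∑ i ∈ firstIdx N N₁, pderiv i φ x ^ 2)) 1 volume ≤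
      ∑ i ∈ firstIdx N N₁, eLpNorm (pderiv i φ) (ENNReal.ofReal (p i)) volume := by
    refine (eLpNorm_mono (g := ∑ i ∈ firstIdx N N₁, fun x => |pderiv i φ x|) fun x => ?_).trans
      ((eLpNorm_sum_le (fun i _ =>
        (hφ.contDiff_pderiv i).continuous.abs.aestronglyMeasurable) le_rfl).trans
        (Finset.sum_le_sum fun i hi => ?_))
    · have h0 : 0 ≤ ∑ i ∈ firstIdx N N₁, |pderiv i φ x| :=
        Finset.sum_nonneg fun _ _ => abs_nonneg _
      rw [Finset.sum_apply, Real.norm_eq_abs, Real.norm_eq_abs, abs_of_nonneg (Real.sqrt_nonneg _),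
        abs_of_nonneg h0]
      refine Real.sqrt_le_iff.2 ⟨h0, ?_⟩
      simp_rw [← sq_abs (pderiv _ φ x)]
      exact Finset.sum_sq_le_sq_sum_of_nonneg fun _ _ => abs_nonneg _
    · rw [hp_one i (by simpa [firstIdx] using hi), ENNReal.ofReal_one]
      exact (eLpNorm_norm (pderiv i φ)).le
  refine (add_le_add_left h1 _).trans (le_of_eq ?_)
  rw [← Finset.sum_filter_add_sum_filter_not Finset.univ (fun i : Fin N => (i : ℕ) < N₁)]
  simp [firstIdx, lastIdx]

/-- Along the approximation the `L^q` norms converge and each derivative norm exceeds that of `u` by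
a vanishing amount at most, so the constant is preserved. -/
theorem troisiIneq_of_test {N₁ : ℕ} (hN : 0 < N) (hN₁ : N₁ ≤ N) {p : Fin N → ℝ}
    (hq : 1 < critExp p) (hp : ∀ i, 1 ≤ p i)
    (hp_one : ∀ i : Fin N, (i : ℕ) < N₁ → p i = 1)
    (hpq : ∀ i, p i < critExp p) (hsum : ∑ i, (1 / p i - 1 / critExp p) = 1)
    {T₀ : ℝ} (hT₀ : 0 < T₀)
    (hT : ∀ φ : EuclideanSpace ℝ (Fin N) → ℝ, IsTest φ →
      ENNReal.ofReal T₀ * eLpNorm φ (ENNReal.ofReal (critExp p)) volume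
        ≤ ∏ i, eLpNorm (pderiv i φ) (ENNReal.ofReal (p i)) volume ^ (1 / (N : ℝ)))
    {u : EuclideanSpace ℝ (Fin N) → ℝ} {D : Grad N} (hD : IsBVGrad N₁ p u D) :
    TroisiIneq N₁ p T₀ u D := by
  have hN0 : (0 : ℝ) < N := by exact_mod_cast hN
  have hfirst : ENNReal.ofReal T₀ * eLpNorm u (ENNReal.ofReal (critExp p)) volume
      ≤ ∏ i, derivNorm N₁ p D i ^ (1 / (N : ℝ)) := by
    obtain ⟨us, hus, hu, hlast, -, ε, hε, hle⟩ := exists_test_approx hq hp hp_one hpq hsum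
      hD.memLp hD.meas hD.func_memLp hD.func
    have hδ := hε.add (tendsto_finsetSum _ hlast)
    rw [Finset.sum_const_zero, add_zero] at hδ
    have h1 := ENNReal.Tendsto.const_mul (a := ENNReal.ofReal T₀)
      (tendsto_eLpNorm_of_tendsto_sub (by simpa using hq.le) (fun n => (hus n).memLp _) hD.memLp hu)
      (Or.inr ENNReal.ofReal_ne_top)
    -- Products of extended reals are continuous only away from zero times infinity; the derivative
    -- norms are finite.
    have h2 := ENNReal.tendsto_finsetProd_of_ne_top Finset.univ (fun i _ =>
      ((ENNReal.continuous_rpow_const (y := 1 / (N : ℝ))).tendsto _).comp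
        (hδ.const_add (derivNorm N₁ p D i))) fun i _ => by
          rw [add_zero]
          exact ENNReal.rpow_ne_top_of_nonneg (by positivity) (derivNorm_ne_top hD i)
    simp only [add_zero] at h2
    refine le_of_tendsto_of_tendsto' h1 h2 fun n => (hT _ (hus n)).trans
      (Finset.prod_le_prod' fun i _ => ENNReal.rpow_le_rpow
        (eLpNorm_pderiv_le_derivNorm_add hp hp_one hD (hus n) (fun S hS => hle S hS n) i)
        (by positivity))
  refine ⟨hfirst, ?_⟩
  have hamgm : ∏ i, derivNorm N₁ p D i ^ (1 / (N : ℝ)) ≤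
      ENNReal.ofReal (1 / N) * ∑ i, derivNorm N₁ p D i := by
    lift derivNorm N₁ p D to Fin N → NNReal using derivNorm_ne_top hD with a
    have hw : ENNReal.ofReal (1 / (N : ℝ)) = ((1 / N : NNReal) : ℝ≥0∞) := by
      rw [← ENNReal.ofReal_coe_nnreal]; simp
    have h := NNReal.geom_mean_le_arith_mean_weighted Finset.univ (fun _ => (1 / N : NNReal)) a
      (by simp [hN.ne'])
    rw [← Finset.mul_sum] at h
    rw [hw]
    simp_rw [← ENNReal.coe_rpow_of_nonneg _ (one_div_nonneg.2 hN0.le)]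
    norm_cast
  have hcard : (firstIdx N N₁).card = N₁ := by
    rw [firstIdx, Fin.card_filter_val_lt, min_eq_right hN₁]
  have hS : ∑ i, derivNorm N₁ p D i ≤ ENNReal.ofReal √(N₁ : ℝ) * mass₁ N₁ D +
      ∑ i ∈ lastIdx N N₁, derivNorm N₁ p D i := by
    rw [← Finset.sum_filter_add_sum_filter_not Finset.univ (fun i : Fin N => (i : ℕ) < N₁)]
    refine add_le_add ?_ (by simp [lastIdx])
    -- Cauchy–Schwarz over the `N₁` measure components is the origin of the factor `√N₁`.
    have h := sum_totalMass_singleton_le (firstIdx N N₁) D.meas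
    rw [hcard] at h
    refine le_trans (Finset.sum_congr rfl fun i hi => ?_).le h
    rw [derivNorm, if_pos (Finset.mem_filter.1 hi).2]
  have hinv : ENNReal.ofReal (1 / T₀) * ENNReal.ofReal T₀ = 1 := by
    rw [← ENNReal.ofReal_mul (by positivity), one_div_mul_cancel hT₀.ne', ENNReal.ofReal_one]
  calc eLpNorm u (ENNReal.ofReal (critExp p)) volume
      = ENNReal.ofReal (1 / T₀) *
          (ENNReal.ofReal T₀ * eLpNorm u (ENNReal.ofReal (critExp p)) volume) := by
        rw [← mul_assoc, hinv, one_mul]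
    _ ≤ ENNReal.ofReal (1 / T₀) * (ENNReal.ofReal (1 / N) * (ENNReal.ofReal √(N₁ : ℝ) * mass₁ N₁ D +
          ∑ i ∈ lastIdx N N₁, derivNorm N₁ p D i)) := by
        exact mul_le_mul_right (hfirst.trans (hamgm.trans (mul_le_mul_right hS _))) _
    _ = _ := by
        rw [← mul_assoc, ← ENNReal.ofReal_mul (by positivity), one_div_mul_one_div]

theorem exists_tight_approx {N₁ : ℕ} {p : Fin N → ℝ} (hq : 1 < critExp p)
    (hp_one : ∀ i : Fin N, (i : ℕ) < N₁ → p i = 1)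
    (hp_gt : ∀ i : Fin N, N₁ ≤ (i : ℕ) → 1 < p i)
    (hpq : ∀ i, p i < critExp p) (hsum : ∑ i, (1 / p i - 1 / critExp p) = 1)
    {u : EuclideanSpace ℝ (Fin N) → ℝ} {D : Grad N} (hD : IsBVGrad N₁ p u D) :
    ∃ us : ℕ → EuclideanSpace ℝ (Fin N) → ℝ, (∀ n, IsTest (us n)) ∧ ConvergesTightly N₁ p us u ∧
      (∃ C : ℝ, ∀ n, testNorm N₁ p (us n) ≤ ENNReal.ofReal C) ∧ ConvergesInDistributions us u := by
  have hp : ∀ i, 1 ≤ p i := fun i => (lt_or_ge (i : ℕ) N₁).elim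
    (fun h => (hp_one i h).ge) fun h => (hp_gt i h).le
  have hq1 : 1 ≤ ENNReal.ofReal (critExp p) := by simpa using hq.le
  obtain ⟨us, hus, hu, hlast, hvague, ε, hε, hle⟩ := exists_test_approx hq hp hp_one hpq hsum
    hD.memLp hD.meas hD.func_memLp hD.func
  have hweak : WeakLp (critExp p) us u :=
    weakLp_of_tendsto_eLpNorm hq (fun n => (hus n).memLp _) hD.memLp hu
  refine ⟨us, hus, ⟨fun n => testGrad (us n), D, ⟨fun n => (hus n).isBVGrad N₁ p, hD, hweak, hvague,
    fun i hi => ?_⟩, fun i hi => ?_, ?_⟩, ?_, hD.memLp.locallyIntegrable hq1, fun φ hφ => ?_⟩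
  · exact weakLp_of_tendsto_eLpNorm (hp_gt i (Finset.mem_filter.1 hi).2)
      (fun n => ((hus n).contDiff_pderiv i).memLp _) (hD.func_memLp i hi) (hlast i hi)
  · have hi0 : 0 < p i := by linarith [hp i]
    rw [integral_abs_rpow_eq hi0 (hD.func_memLp i hi)]
    have h1 := tendsto_eLpNorm_of_tendsto_sub (by simpa using hp i)
      (fun n => ((hus n).contDiff_pderiv i).memLp _) (hD.func_memLp i hi) (hlast i hi)
    refine (((ENNReal.tendsto_toReal (hD.func_memLp i hi).eLpNorm_ne_top).comp h1).rpow_const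
      (Or.inr hi0.le)).congr fun n => ?_
    exact (integral_abs_rpow_eq hi0 (((hus n).contDiff_pderiv i).memLp _)).symm
  · exact tendsto_totalMass hvague hε fun n => hle _ subset_rfl n
  · have hδ := hε.add (tendsto_finsetSum _ hlast)
    rw [Finset.sum_const_zero, add_zero] at hδ
    -- The approximation bounds the norms only from some index on, where the error is at most one;
    -- the finitely many earlier norms are finite and are absorbed in the constant.
    refine exists_ofReal_bound (K := ∑ i, (derivNorm N₁ p D i + 1)) (fun n => ?_) ?_ ?_
    · exact ne_top_of_le_ne_top (ENNReal.sum_ne_top.2 fun i _ =>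
        (((hus n).contDiff_pderiv i).memLp _).eLpNorm_ne_top) (testNorm_le_sum hp_one (hus n))
    · exact ENNReal.sum_ne_top.2 fun i _ =>
        ENNReal.add_ne_top.2 ⟨derivNorm_ne_top hD i, ENNReal.one_ne_top⟩
    · filter_upwards [hδ.eventually_le_const one_pos] with n hn
      exact (testNorm_le_sum hp_one (hus n)).trans (Finset.sum_le_sum fun i _ =>
        (eLpNorm_pderiv_le_derivNorm_add hp hp_one hD (hus n) (fun S hS => hle S hS n) i).trans
          (by gcongr))
  · exact hweak φ (hφ.memLp _)

end AnisoBV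

/-! ### The equivalences and the Troisi embedding -/

theorem mainTheorem5 (N N₁ : ℕ) (hN₁ : N₁ ≤ N) (p : Fin N → ℝ)
    (hp_one : ∀ i : Fin N, (i : ℕ) < N₁ → p i = 1)
    (hp_gt : ∀ i : Fin N, N₁ ≤ (i : ℕ) → 1 < p i)
    (hp_sum : 1 < ∑ i, 1 / p i)
    (hp_crit : ∀ i, p i < critExp p) :
    (∀ u : EuclideanSpace ℝ (Fin N) → ℝ,
      List.TFAE [
        u ∈ BV N₁ p,
        ∃ us : ℕ → EuclideanSpace ℝ (Fin N) → ℝ,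
          (∀ n, IsTest (us n)) ∧ ConvergesTightly N₁ p us u,
        ∃ us : ℕ → EuclideanSpace ℝ (Fin N) → ℝ,
          (∀ n, IsTest (us n)) ∧ ConvergesWeakly N₁ p us u,
        ∃ us : ℕ → EuclideanSpace ℝ (Fin N) → ℝ,
          (∀ n, IsTest (us n)) ∧ (∃ C : ℝ, ∀ n, testNorm N₁ p (us n) ≤ ENNReal.ofReal C) ∧
            ConvergesInDistributions us u]) ∧
    (∃ T₀ : ℝ, 0 < T₀ ∧ ∀ (u : EuclideanSpace ℝ (Fin N) → ℝ) (D : Grad N),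
      IsBVGrad N₁ p u D → TroisiIneq N₁ p T₀ u D) ∧
    (∀ T₀ : ℝ, 0 < T₀ →
      (∀ φ : EuclideanSpace ℝ (Fin N) → ℝ, IsTest φ →
        ENNReal.ofReal T₀ * eLpNorm φ (ENNReal.ofReal (critExp p)) volume
          ≤ ∏ i, eLpNorm (pderiv i φ) (ENNReal.ofReal (p i)) volume ^ (1 / (N : ℝ))) →
      ∀ (u : EuclideanSpace ℝ (Fin N) → ℝ) (D : Grad N),
        IsBVGrad N₁ p u D → TroisiIneq N₁ p T₀ u D) := by
  have hp : ∀ i, 1 ≤ p i := fun i => (lt_or_ge (i : ℕ) N₁).elim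
    (fun h => (hp_one i h).ge) fun h => (hp_gt i h).le
  -- Each `1 / p i` is at most one while their sum exceeds one.
  have hN : 2 ≤ N := by
    have h1 : ∑ i, 1 / p i ≤ ∑ _i : Fin N, (1 : ℝ) := Finset.sum_le_sum fun i _ => by
      rw [div_le_one (by linarith [hp i])]
      exact hp i
    rw [Finset.sum_const, Finset.card_univ, Fintype.card_fin, nsmul_eq_mul, mul_one] at h1
    have h2 : ((1 : ℕ) : ℝ) < N := by push_cast; linarith
    exact_mod_cast h2
  have hN0 : (N : ℝ) ≠ 0 := by positivity
  have hq : 1 < critExp p := (hp ⟨0, by omega⟩).trans_lt (hp_crit _)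
  -- This identity is the definition of the critical exponent in the form used throughout.
  have hsum : ∑ i, (1 / p i - 1 / critExp p) = 1 := by
    have h1 : (∑ i, 1 / p i) - 1 ≠ 0 := by linarith
    rw [Finset.sum_sub_distrib, Finset.sum_const, Finset.card_univ, Fintype.card_fin, nsmul_eq_mul,
      critExp, one_div_div, mul_div_cancel₀ _ hN0]
    ring
  obtain ⟨T₀, hT₀, hT⟩ := exists_troisi_test hN (zero_lt_one.trans hq) hp hsum
  refine ⟨fun u => ?_, ⟨T₀, hT₀, fun u D hD => troisiIneq_of_test (by omega) hN₁ hq hp hp_one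
    hp_crit hsum hT₀ hT hD⟩, fun T₁ hT₁ h u D hD => troisiIneq_of_test (by omega) hN₁ hq hp hp_one
    hp_crit hsum hT₁ h hD⟩
  tfae_have 1 → 2 := fun h => by
    obtain ⟨D, hD⟩ := mem_BV_iff.1 h
    obtain ⟨us, hus, ht, -⟩ := exists_tight_approx hq hp_one hp_gt hp_crit hsum hD
    exact ⟨us, hus, ht⟩
  tfae_have 2 → 3 := fun ⟨us, hus, Ds, D, h, _⟩ => ⟨us, hus, Ds, D, h⟩
  -- Weak convergence includes that the limit belongs to BV, so nothing is left to prove.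
  tfae_have 3 → 1 := fun ⟨_, _, _, D, h⟩ => mem_BV_iff.2 ⟨D, h.lim_grad⟩
  tfae_have 1 → 4 := fun h => by
    obtain ⟨D, hD⟩ := mem_BV_iff.1 h
    obtain ⟨us, hus, -, hb, hc⟩ := exists_tight_approx hq hp_one hp_gt hp_crit hsum hD
    exact ⟨us, hus, hb, hc⟩
  tfae_have 4 → 1 := fun ⟨_, hus, ⟨_, hC⟩, hu⟩ =>
    mem_BV_of_testNorm_le hq hp_one hp_gt hT₀ hT hus hC hu
  tfae_finish
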